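/- Let $d\ge 1$, let $p\in(1,\infty)$ and $\gamma\in(0,1)$, and let $F$ be a finite-dimensional real inner product space with inner product $a\cdot b$ (for example $F=\mathbb R$, the scalar case, or $F=\mathbb R^d$, the case of vector fields). For bounded Lipschitz functions $g$ on $\mathbb R^d$ put $$(-\Delta)^{\gamma/2}g(x)=c_{d,\gamma}\int_{\mathbb R^d}\frac{g(x)-g(y)}{|x-y|^{d+\gamma}}\,dy,\qquad c_{d,\gamma}=\frac{2^{\gamma}\,\Gamma\!\left(\frac{d+\gamma}{2}\right)}{\pi^{d/2}\,|\Gamma(-\gamma/2)|}.$$ Let $\mathrm{BMO}(\mathbb R^d;F)$ be the space of locally integrable $\psi:\mathbb R^d\to F$ with $$\|\psi\|_{\mathrm{BMO}}=\sup_{B}\frac1{|B|}\int_{B}\Big|\psi-\frac1{|B|}\int_{B}\psi\Big|\,dx<\infty,$$ the supremum being over all balls $B\subset\mathbb R^d$. A function $f:\mathbb R^d\to F$ belongs to $\mathrm{BMO}^{-\gamma}(\mathbb R^d;F)$ if there is $\psi\in \mathrm{BMO}(\mathbb R^d;F)$ with $f=(-\Delta)^{\gamma/2}\psi$ in the sense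 of distributions, that is, $\int \varphi f\,dx=\int \psi\,(-\Delta)^{\gamma/2}\varphi\,dx$ for all real-valued $\varphi\in C_c^\infty(\mathbb R^d)$; then $\|f\|_{\mathrm{BMO}^{-\gamma}}=\|\psi\|_{\mathrm{BMO}}$ (such a $\psi$ is unique up to an additive constant; equivalently, take the infimum over all such $\psi$). Let $W^{1,\infty}(\mathbb R^d;F)$ be the space of functions in $L^\infty$ with weak first derivatives in $L^\infty$. Then there is a positive constant $C$, depending only on $p$, $\gamma$, $d$ and $F$, such that for every $f\in C^\infty(\mathbb R^d;F)\cap \mathrm{BMO}^{-\gamma}(\mathbb R^d;F)$ and every $g\in W^{1,\infty}(\mathbb R^d;F)$ that vanishes almost everywhere outside the cube $B_1=[-1,1]^d$ (in particular, every such $g$ supported in the closed Euclidean unit ball), the function $f\cdot g$ is integrable, $(-\Delta)^{\gamma/2}g\in L^p(\mathbb R^d;F)$, and $$\int_{\mathbb R^d} f\cdot g\,dx\;\le\; C\,\|f\|_{\mathrm{BMO}^{-\gamma}(\mathbb R^d)}\Big(\big\|(-\Delta)^{\gamma/2}g\big\|_{L^p(\mathbb R^d)}+\|g\|_{L^1(\mathbb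 R^d)}\Big).$$ -/

import Mathlib

open MeasureTheory
open scoped ENNReal ContDiff RealInnerProductSpace

noncomputable section

namespace NegBMO

/-- The constant `c_{d,γ} = 2^γ Γ((d+γ)/2) / (π^{d/2} |Γ(-γ/2)|)`, for which the operator
`fracLaplacian` below has Fourier symbol `|ξ|^γ`. -/
def fracConst (d : ℕ) (γ : ℝ) : ℝ :=
  2 ^ γ * Real.Gamma (((d : ℝ) + γ) / 2) /
    (Real.pi ^ ((d : ℝ) / 2) * |Real.Gamma (-γ / 2)|)

/-- The fractional Laplacian `(-Δ)^{γ/2}` on `ℝ^d` for `0 < γ < 1`,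
`(-Δ)^{γ/2} g (x) = c_{d,γ} ∫ (g x - g y) / |x - y|^{d+γ} dy`.
For `0 < γ < 1` and `g` bounded and Lipschitz the integral converges absolutely at every `x`, so
that no principal value is needed. Changing `g` on a null set changes the result only on a
null set. -/
def fracLaplacian {d : ℕ} {F : Type*} [NormedAddCommGroup F] [NormedSpace ℝ F] (γ : ℝ)
    (g : EuclideanSpace ℝ (Fin d) → F) (x : EuclideanSpace ℝ (Fin d)) : F :=
  fracConst d γ • ∫ y, (‖x - y‖ ^ ((d : ℝ) + γ))⁻¹ • (g x - g y)

/-- The `BMO` seminorm `sup_B ⨍_B |ψ - ⨍_B ψ|`, the supremum over all balls `B` of `ℝ^d`. -/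
def bmoNorm {d : ℕ} {F : Type*} [NormedAddCommGroup F] [NormedSpace ℝ F]
    (ψ : EuclideanSpace ℝ (Fin d) → F) : ℝ≥0∞ :=
  ⨆ (x : EuclideanSpace ℝ (Fin d)) (r : ℝ) (_ : 0 < r),
    ⨍⁻ y in Metric.ball x r, ‖ψ y - ⨍ z in Metric.ball x r, ψ z ∂volume‖ₑ ∂volume

/-- `ψ ∈ BMO(ℝ^d; F)`. -/
def MemBMO {d : ℕ} {F : Type*} [NormedAddCommGroup F] [NormedSpace ℝ F]
    (ψ : EuclideanSpace ℝ (Fin d) → F) : Prop :=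
  LocallyIntegrable ψ ∧ bmoNorm ψ < ⊤

/-- The identity `f = (-Δ)^{γ/2} ψ` in the sense of distributions: by duality,
`∫ φ f = ∫ ((-Δ)^{γ/2} φ) ψ` for all real test functions `φ ∈ C_c^∞(ℝ^d)`.
(For vector-valued `f` and `ψ` this is the identity of all components.) -/
def IsFracLaplacianOf {d : ℕ} {F : Type*} [NormedAddCommGroup F] [NormedSpace ℝ F] (γ : ℝ)
    (f ψ : EuclideanSpace ℝ (Fin d) → F) : Prop :=
  ∀ φ : EuclideanSpace ℝ (Fin d) → ℝ, ContDiff ℝ ∞ φ → HasCompactSupport φ →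
    ∫ x, φ x • f x = ∫ x, fracLaplacian γ φ x • ψ x

/-- `f ∈ BMO^{-γ}(ℝ^d; F)`, for a function `f`: there is `ψ ∈ BMO` with `f = (-Δ)^{γ/2} ψ`. -/
def MemNegBMO {d : ℕ} {F : Type*} [NormedAddCommGroup F] [NormedSpace ℝ F] (γ : ℝ)
    (f : EuclideanSpace ℝ (Fin d) → F) : Prop :=
  ∃ ψ : EuclideanSpace ℝ (Fin d) → F, MemBMO ψ ∧ IsFracLaplacianOf γ f ψ

/-- The norm `‖f‖_{BMO^{-γ}} = ‖ψ‖_{BMO}`, where `ψ ∈ BMO` and `f = (-Δ)^{γ/2} ψ`. Such a `ψ` is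
unique up to an additive constant and the `BMO` seminorm ignores constants, so the infimum is
over at most one value (it is `⊤` if there is no such `ψ`). -/
def negBMONorm {d : ℕ} {F : Type*} [NormedAddCommGroup F] [NormedSpace ℝ F] (γ : ℝ)
    (f : EuclideanSpace ℝ (Fin d) → F) : ℝ≥0∞ :=
  ⨅ (ψ : EuclideanSpace ℝ (Fin d) → F) (_ : MemBMO ψ ∧ IsFracLaplacianOf γ f ψ), bmoNorm ψ

/-- `g ∈ W^{1,∞}(ℝ^d; F)`: both `g` and its weak derivative `G` are in `L^∞`. -/
def MemW1Infty {d : ℕ} {F : Type*} [NormedAddCommGroup F] [NormedSpace ℝ F]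
    (g : EuclideanSpace ℝ (Fin d) → F) : Prop :=
  MemLp g ⊤ ∧
    ∃ G : EuclideanSpace ℝ (Fin d) → EuclideanSpace ℝ (Fin d) →L[ℝ] F, MemLp G ⊤ ∧
      ∀ φ : EuclideanSpace ℝ (Fin d) → ℝ, ContDiff ℝ ∞ φ → HasCompactSupport φ →
        ∀ v : EuclideanSpace ℝ (Fin d),
          ∫ x, (fderiv ℝ φ x v) • g x = - ∫ x, φ x • G x v

/-- The closed set `B_1 = [-1,1]^d`; it contains the closed Euclidean unit ball. -/
def unitBox (d : ℕ) : Set (EuclideanSpace ℝ (Fin d)) := {x | ∀ i, |x i| ≤ 1}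

end NegBMO

end

namespace NegBMO

open Metric Set Filter Topology Module
open scoped NNReal

set_option linter.unusedSectionVars false

/-! ### The John–Nirenberg inequality. -/

noncomputable section JohnNirenberg

variable {E F : Type*} [NormedAddCommGroup E] [NormedSpace ℝ E] [FiniteDimensional ℝ E]
  [MeasurableSpace E] [BorelSpace E] {μ : Measure E} [μ.IsAddHaarMeasure]
  [NormedAddCommGroup F] [NormedSpace ℝ F] [CompleteSpace F]

/-! Write `f = (-Δ)^{γ/2} ψ` with `ψ` in BMO. Moving the operator onto `g` gives `∫ f · g = ∫ ψ ·
(-Δ)^{γ/2} g`. Since `(-Δ)^{γ/2} g` has integral zero, `ψ` may be replaced by `ψ - m`, where `m` is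
its mean over the ball `b` of radius `2d`; the support of `g` lies in the ball of radius `d`.

On `b`, Hölder's inequality leaves the `L^p` norm of `(-Δ)^{γ/2} g` times the `L^q` norm of `ψ - m`
with `q` conjugate to `p`, and the latter is controlled by John–Nirenberg
(`OscillationBound.lintegral_rpow_le`). Off `b`, the kernel is evaluated at distance comparable to
`1 + ‖x‖`, so `(-Δ)^{γ/2} g` is at most a constant times `‖g‖_{L^1} (1 + ‖x‖)^{-(d+γ)}`
(`BddLipschitz.norm_fracLaplacian_le_of_far`). This weight is integrable against `‖ψ - m‖`, because
means over dyadic balls drift only linearly in the dyadic scale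
(`OscillationBound.lintegral_weight_le`). `enorm_integral_inner_le` adds the two halves.

The distributional identity allows only smooth scalar test functions. A `W^{1,∞}` function with
support in the box is therefore replaced by a Lipschitz representative
(`MemW1Infty.exists_bddLipschitz`), and the identity is extended by mollification and dominated
convergence, then coordinatewise (`IsFracLaplacianOf.integral_inner_eq`). The Lipschitz constant
serves only qualitatively, for convergence, and does not enter the final constant. -/

/-- `ψ` is locally integrable and its mean oscillation over every ball is at most `N`. -/
structure OscillationBound (μ : Measure E) (ψ : E → F) (N : ℝ≥0∞) : Prop where
  locallyIntegrable : LocallyIntegrable ψ μ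
  lintegral_le : ∀ x r, 0 < r →
    ∫⁻ y in ball x r, ‖ψ y - ⨍ z in ball x r, ψ z ∂μ‖ₑ ∂μ ≤ N * μ (ball x r)

lemma integrableOn_ball_sub {ψ : E → F} (hψ : LocallyIntegrable ψ μ) (c : F) (x : E) (r : ℝ) :
    IntegrableOn (fun y => ψ y - c) (ball x r) μ :=
  ((hψ.sub (locallyIntegrable_const c)).integrableOn_isCompact
    (isCompact_closedBall x r)).mono_set ball_subset_closedBall

lemma measure_ball_ne_zero' (x : E) {r : ℝ} (hr : 0 < r) : μ (ball x r) ≠ 0 :=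
  (measure_ball_pos μ x hr).ne'

lemma enorm_setAverage_sub_mul_le {ψ : E → F} (hψ : LocallyIntegrable ψ μ) (c : F) (x : E) {r : ℝ}
    (hr : 0 < r) :
    ‖(⨍ z in ball x r, ψ z ∂μ) - c‖ₑ * μ (ball x r) ≤ ∫⁻ y in ball x r, ‖ψ y - c‖ₑ ∂μ := by
  have h0 : μ (ball x r) ≠ 0 := measure_ball_ne_zero' x hr
  have ht : μ (ball x r) ≠ ⊤ := measure_ball_lt_top.ne
  have hi : IntegrableOn ψ (ball x r) μ := by simpa using integrableOn_ball_sub hψ 0 x r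
  have h1 : ∫ y in ball x r, (ψ y - c) ∂μ
      = μ.real (ball x r) • ((⨍ z in ball x r, ψ z ∂μ) - c) := by
    rw [integral_sub hi (integrableOn_const ht), smul_sub, setIntegral_const,
      measure_smul_setAverage _ ht]
  have h2 := enorm_integral_le_lintegral_enorm (μ := μ.restrict (ball x r)) (fun y => ψ y - c)
  rw [h1, enorm_smul, mul_comm] at h2
  refine le_trans (le_of_eq ?_) h2
  rw [Real.enorm_eq_ofReal measureReal_nonneg, ofReal_measureReal ht]

lemma measure_ball_mul (x : E) {K : ℝ} (hK : 0 < K) (r : ℝ) :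
    μ (ball x (K * r)) = ENNReal.ofReal K ^ finrank ℝ E * μ (ball x r) := by
  rw [Measure.addHaar_ball_mul_of_pos μ x hK, Measure.addHaar_ball_center μ x,
    ENNReal.ofReal_pow hK.le]

/-- Replacing the mean over a ball by the mean over a concentric larger ball. -/
lemma OscillationBound.enorm_setAverage_sub_le {ψ : E → F} {N : ℝ≥0∞}
    (h : OscillationBound μ ψ N) (x : E) {r K : ℝ} (hr : 0 < r) (hK : 1 ≤ K) :
    ‖(⨍ z in ball x r, ψ z ∂μ) - ⨍ z in ball x (K * r), ψ z ∂μ‖ₑ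
      ≤ N * ENNReal.ofReal K ^ finrank ℝ E := by
  have hK0 : 0 < K := by linarith
  have h0 : μ (ball x r) ≠ 0 := measure_ball_ne_zero' x hr
  have ht : μ (ball x r) ≠ ⊤ := measure_ball_lt_top.ne
  have h1 := enorm_setAverage_sub_mul_le h.locallyIntegrable
    (⨍ z in ball x (K * r), ψ z ∂μ) x hr
  have h2 : ball x r ⊆ ball x (K * r) := ball_subset_ball (by nlinarith)
  have h3 := h1.trans ((lintegral_mono_set h2).trans (h.lintegral_le x (K * r) (by positivity)))
  rw [measure_ball_mul x hK0, ← mul_assoc] at h3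
  exact (ENNReal.mul_le_mul_iff_left h0 ht).1 h3

/-- Oscillation over a larger concentric ball about the mean over the smaller one. -/
lemma OscillationBound.lintegral_ball_mul_le {ψ : E → F} {N : ℝ≥0∞}
    (h : OscillationBound μ ψ N) (x : E) {r K : ℝ} (hr : 0 < r) (hK : 1 ≤ K) :
    ∫⁻ y in ball x (K * r), ‖ψ y - ⨍ z in ball x r, ψ z ∂μ‖ₑ ∂μ
      ≤ N * ENNReal.ofReal K ^ finrank ℝ E * (1 + ENNReal.ofReal K ^ finrank ℝ E)
        * μ (ball x r) := by
  have hK0 : 0 < K := by linarith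
  calc ∫⁻ y in ball x (K * r), ‖ψ y - ⨍ z in ball x r, ψ z ∂μ‖ₑ ∂μ
      ≤ ∫⁻ y in ball x (K * r), (‖ψ y - ⨍ z in ball x (K * r), ψ z ∂μ‖ₑ
          + ‖(⨍ z in ball x r, ψ z ∂μ) - ⨍ z in ball x (K * r), ψ z ∂μ‖ₑ) ∂μ := by
        refine lintegral_mono fun y => ?_
        rw [← edist_eq_enorm_sub, ← edist_eq_enorm_sub, ← edist_eq_enorm_sub]
        exact edist_triangle_right _ _ _
    _ ≤ N * μ (ball x (K * r)) + N * ENNReal.ofReal K ^ finrank ℝ E * μ (ball x (K * r)) := by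
        rw [lintegral_add_right _ measurable_const, setLIntegral_const]
        gcongr
        · exact h.lintegral_le x _ (by positivity)
        · exact h.enorm_setAverage_sub_le x hr hK
    _ = _ := by rw [measure_ball_mul x hK0]; ring

/-- The constant in the level set decay `OscillationBound.measure_lt_enorm_le`. -/
def decayConst (E : Type*) [NormedAddCommGroup E] [NormedSpace ℝ E] : ℝ≥0∞ :=
  2 * 6 ^ finrank ℝ E * (2 ^ finrank ℝ E * (1 + 2 ^ finrank ℝ E))

lemma decayConst_ne_top : decayConst E ≠ ⊤ := by
  unfold decayConst; finiteness

/-- This makes the mean deviation at the initial radius stay below the threshold, so that the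
stopping argument can start. -/
lemma le_decayConst : 2 ^ finrank ℝ E * (1 + 2 ^ finrank ℝ E) ≤ decayConst E := by
  unfold decayConst
  refine le_mul_of_one_le_left (by positivity) ?_
  calc (1 : ℝ≥0∞) ≤ 2 * 1 := by norm_num
    _ ≤ 2 * 6 ^ finrank ℝ E := by gcongr; exact one_le_pow₀ (by norm_num)

/-- Stopping radius: a point of large deviation is the centre of a small ball with large mean
deviation whose sixfold enlargement has not. -/
lemma exists_stopping_radius [Nontrivial E] {ψ : E → F} (hψ : LocallyIntegrable ψ μ) (c : F)
    (Λ : ℝ≥0∞) {r : ℝ} (hr : 0 < r) :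
    ∀ᵐ y ∂μ, Λ < ‖ψ y - c‖ₑ →
      ∫⁻ z in closedBall y r, ‖ψ z - c‖ₑ ∂μ ≤ Λ * μ (closedBall y r) →
      ∃ s, 0 < s ∧ 6 * s ≤ r ∧ Λ * μ (closedBall y s) < ∫⁻ z in closedBall y s, ‖ψ z - c‖ₑ ∂μ ∧
        ∫⁻ z in closedBall y (6 * s), ‖ψ z - c‖ₑ ∂μ ≤ Λ * μ (closedBall y (6 * s)) := by
  have hu : LocallyIntegrable (fun y => ‖ψ y - c‖) μ := fun y => (hψ.sub (locallyIntegrable_const c) y).norm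
  -- Lebesgue differentiation along the radii `r / 6 ^ k`: at almost every point with `Λ < ‖ψ y -
  -- c‖ₑ` some average exceeds `Λ`. The first such radius is the stopping radius.
  filter_upwards [IsUnifLocDoublingMeasure.ae_tendsto_average μ hu 1] with y hy hΛ hbig
  have hδ : Tendsto (fun k : ℕ => r * (1 / 6 : ℝ) ^ k) atTop (𝓝[>] 0) := by
    refine tendsto_nhdsWithin_iff.2 ⟨?_, Eventually.of_forall fun k => by
      simp only [mem_Ioi]; positivity⟩
    simpa using (tendsto_pow_atTop_nhds_zero_of_lt_one (r := (1 / 6 : ℝ)) (by norm_num)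
      (by norm_num)).const_mul r
  have hlim := hy (fun _ => y) _ hδ (Eventually.of_forall fun k => by
    simp only [mem_closedBall, dist_self]; positivity)
  have hlim' := (ENNReal.continuous_ofReal.tendsto _).comp hlim
  rw [ofReal_norm] at hlim'
  have hex : ∃ k : ℕ, Λ * μ (closedBall y (r * (1 / 6 : ℝ) ^ k))
      < ∫⁻ z in closedBall y (r * (1 / 6 : ℝ) ^ k), ‖ψ z - c‖ₑ ∂μ := by
    obtain ⟨k, hk⟩ := (hlim'.eventually_const_lt hΛ).exists
    refine ⟨k, ?_⟩
    have hpos : 0 < r * (1 / 6 : ℝ) ^ k := by positivity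
    have h0 : μ (closedBall y (r * (1 / 6 : ℝ) ^ k)) ≠ 0 := (measure_closedBall_pos μ y hpos).ne'
    have ht : μ (closedBall y (r * (1 / 6 : ℝ) ^ k)) ≠ ⊤ := measure_closedBall_lt_top.ne
    have hi : IntegrableOn (fun z => ψ z - c) (closedBall y (r * (1 / 6 : ℝ) ^ k)) μ :=
      (hψ.sub (locallyIntegrable_const c)).integrableOn_isCompact (isCompact_closedBall _ _)
    have h1 := ofReal_integral_norm_eq_lintegral_enorm hi
    rw [← h1, ← measure_smul_setAverage _ ht, smul_eq_mul, ENNReal.ofReal_mul measureReal_nonneg,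
      ofReal_measureReal ht, mul_comm]
    exact (ENNReal.mul_lt_mul_iff_right h0 ht).2 hk
  classical
  -- The bound at radius `r` itself excludes `k = 0`, so the first bad radius has a good
  -- predecessor, six times as large.
  have hk0 : Nat.find hex ≠ 0 := by
    intro h0
    have := Nat.find_spec hex
    rw [h0] at this
    simp only [pow_zero, mul_one] at this
    exact absurd hbig (not_le.2 this)
  obtain ⟨m, hm⟩ := Nat.exists_eq_succ_of_ne_zero hk0
  have h6 : 6 * (r * (1 / 6 : ℝ) ^ (m + 1)) = r * (1 / 6 : ℝ) ^ m := by rw [pow_succ]; ring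
  refine ⟨r * (1 / 6 : ℝ) ^ (m + 1), by positivity, ?_, ?_, ?_⟩
  · rw [h6]
    exact mul_le_of_le_one_right hr.le (pow_le_one₀ (by norm_num) (by norm_num))
  · have := Nat.find_spec hex
    rwa [hm] at this
  · rw [h6]
    exact not_lt.1 (Nat.find_min hex (by omega : m < Nat.find hex))

/-- **John–Nirenberg**: the level sets of the deviation from the mean decay geometrically. -/
theorem OscillationBound.measure_lt_enorm_le [Nontrivial E] {ψ : E → F} {N : ℝ≥0∞}
    (h : OscillationBound μ ψ N) (hN0 : N ≠ 0) (hN : N ≠ ⊤) (n : ℕ) :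
    ∀ x r, 0 < r → μ {y ∈ ball x r | n * (decayConst E * N) < ‖ψ y - ⨍ z in ball x r, ψ z ∂μ‖ₑ}
      ≤ 2⁻¹ ^ n * μ (ball x r) := by
  -- The claim concerns all balls at once: level `n + 1` on one ball uses level `n` on the enlarged
  -- stopping balls inside the argument.
  induction n with
  | zero =>
    intro x r _
    simpa using measure_mono fun y hy => hy.1
  | succ n ih =>
    intro x r hr
    set c := ⨍ z in ball x r, ψ z ∂μ
    set Λ := decayConst E * N with hΛ
    have hΛt : Λ ≠ ⊤ := ENNReal.mul_ne_top decayConst_ne_top hN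
    set D : ℝ≥0∞ := 2 ^ finrank ℝ E
    have hball : ∫⁻ z in ball x (2 * r), ‖ψ z - c‖ₑ ∂μ ≤ N * (D * (1 + D)) * μ (ball x r) := by
      have := h.lintegral_ball_mul_le x hr (one_le_two)
      rwa [ENNReal.ofReal_ofNat, mul_assoc N] at this
    set T := {y ∈ ball x r | ((n + 1 : ℕ) : ℝ≥0∞) * Λ < ‖ψ y - c‖ₑ}
    have hT : ∀ y ∈ T, Λ < ‖ψ y - c‖ₑ := fun y hy => lt_of_le_of_lt
      (by push_cast; rw [add_mul, one_mul]; exact le_add_self) hy.2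
    have hsub : ∀ y ∈ T, closedBall y r ⊆ ball x (2 * r) := fun y hy =>
      closedBall_subset_ball' (by have := mem_ball.1 hy.1; linarith)
    have hae := exists_stopping_radius h.locallyIntegrable c Λ hr
    have hae' : ∀ᵐ y ∂μ, y ∈ T → ∃ s, 0 < s ∧ 6 * s ≤ r ∧
        Λ * μ (closedBall y s) < ∫⁻ z in closedBall y s, ‖ψ z - c‖ₑ ∂μ ∧
        ∫⁻ z in closedBall y (6 * s), ‖ψ z - c‖ₑ ∂μ ≤ Λ * μ (closedBall y (6 * s)) := by
      filter_upwards [hae] with y hy hyT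
      refine hy (hT y hyT) (((lintegral_mono_set (hsub y hyT)).trans hball).trans ?_)
      rw [Measure.addHaar_closedBall_eq_addHaar_ball, Measure.addHaar_ball_center μ x,
        ← Measure.addHaar_ball_center μ y, hΛ, mul_comm (decayConst E)]
      gcongr
      exact le_decayConst
    set G := {y | y ∈ T ∧ ∃ s, 0 < s ∧ 6 * s ≤ r ∧
        Λ * μ (closedBall y s) < ∫⁻ z in closedBall y s, ‖ψ z - c‖ₑ ∂μ ∧
        ∫⁻ z in closedBall y (6 * s), ‖ψ z - c‖ₑ ∂μ ≤ Λ * μ (closedBall y (6 * s))}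
    have hG : ∀ y ∈ G, ∃ s, 0 < s ∧ 6 * s ≤ r ∧
        Λ * μ (closedBall y s) < ∫⁻ z in closedBall y s, ‖ψ z - c‖ₑ ∂μ ∧
        ∫⁻ z in closedBall y (6 * s), ‖ψ z - c‖ₑ ∂μ ≤ Λ * μ (closedBall y (6 * s)) :=
      fun y hy => hy.2
    choose! s hs0 hsr hlow hhigh using hG
    -- Vitali enlargement by 5 leaves room: the closed fivefold balls lie in the open sixfold balls,
    -- on which the stopping rule bounds the mean deviation.
    obtain ⟨u, huG, hdisj, hcov⟩ := Vitali.exists_disjoint_subfamily_covering_enlargement_closedBall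
      G id s r (fun a ha => by have := hs0 a ha; have := hsr a ha; linarith) 5 (by norm_num)
    have hu : u.Countable := hdisj.countable_of_nonempty_interior fun a ha =>
      (nonempty_ball.2 (hs0 a (huG ha))).mono ball_subset_interior_closedBall
    have hcover : T ≤ᵐ[μ] ⋃ j ∈ u, {y ∈ ball j (6 * s j) | n * Λ <
        ‖ψ y - ⨍ z in ball j (6 * s j), ψ z ∂μ‖ₑ} := by
      filter_upwards [hae'] with y hy hyT
      obtain ⟨j, hj, hyj⟩ := hcov y ⟨hyT, hy hyT⟩
      have hj0 := hs0 j (huG hj)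
      refine mem_iUnion₂.2 ⟨j, hj, ?_, ?_⟩
      · have : y ∈ closedBall j (5 * s j) :=
          hyj (mem_closedBall_self (hs0 y ⟨hyT, hy hyT⟩).le)
        exact closedBall_subset_ball (by linarith) this
      · set m := ⨍ z in ball j (6 * s j), ψ z ∂μ
        -- Passing from `c` to the mean over the sixfold ball costs one unit `Λ`, hence the drop
        -- from level `n + 1` to level `n`.
        have hmc : ‖m - c‖ₑ ≤ Λ := by
          have h6 : 0 < 6 * s j := by positivity
          have h1 := (enorm_setAverage_sub_mul_le h.locallyIntegrable c j h6).trans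
            ((lintegral_mono_set ball_subset_closedBall).trans (hhigh j (huG hj)))
          rw [Measure.addHaar_closedBall_eq_addHaar_ball] at h1
          exact (ENNReal.mul_le_mul_iff_left (measure_ball_ne_zero' j h6)
            measure_ball_lt_top.ne).1 h1
        have h2 : n * Λ + Λ < ‖ψ y - m‖ₑ + Λ := by
          calc n * Λ + Λ = ((n + 1 : ℕ) : ℝ≥0∞) * Λ := by push_cast; ring
            _ < ‖ψ y - c‖ₑ := hyT.2
            _ ≤ ‖ψ y - m‖ₑ + ‖m - c‖ₑ := by
              rw [← edist_eq_enorm_sub, ← edist_eq_enorm_sub, ← edist_eq_enorm_sub]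
              exact edist_triangle _ _ _
            _ ≤ _ := by gcongr
        exact (ENNReal.add_lt_add_iff_right hΛt).1 h2
    have hsum : ∑' j : u, μ (closedBall (j : E) (s j)) * Λ ≤ N * (D * (1 + D)) * μ (ball x r) := by
      calc ∑' j : u, μ (closedBall (j : E) (s j)) * Λ
          ≤ ∑' j : u, ∫⁻ z in closedBall (j : E) (s j), ‖ψ z - c‖ₑ ∂μ := by
            refine ENNReal.tsum_le_tsum fun j => ?_
            rw [mul_comm]; exact (hlow j (huG j.2)).le
        _ = ∫⁻ z in ⋃ j ∈ u, closedBall j (s j), ‖ψ z - c‖ₑ ∂μ :=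
            (lintegral_biUnion hu (fun _ _ => measurableSet_closedBall) hdisj _).symm
        _ ≤ ∫⁻ z in ball x (2 * r), ‖ψ z - c‖ₑ ∂μ := by
            refine lintegral_mono_set (iUnion₂_subset fun j hj => ?_)
            have h0 := hs0 j (huG hj)
            have h1 := hsr j (huG hj)
            exact (closedBall_subset_closedBall (by linarith)).trans (hsub j (huG hj).1)
        _ ≤ _ := hball
    have hB0 : N * (D * (1 + D)) ≠ 0 := by
      simp [D, hN0]
    have hBt : N * (D * (1 + D)) ≠ ⊤ := by
      simp only [D]; finiteness
    -- The factors of `decayConst` are spent here: cancelling `N * (D * (1 + D))`, which is nonzero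
    -- and finite, leaves `6 ^ dim` to pay for the enlargement and `2` for the halving.
    have hsum' : 2 * 6 ^ finrank ℝ E * ∑' j : u, μ (closedBall (j : E) (s j)) ≤ μ (ball x r) := by
      refine (ENNReal.mul_le_mul_iff_right hB0 hBt).1 (le_trans (le_of_eq ?_) hsum)
      rw [ENNReal.tsum_mul_right, hΛ, decayConst]
      ring
    calc μ T ≤ μ (⋃ j ∈ u, {y ∈ ball j (6 * s j) | n * Λ <
        ‖ψ y - ⨍ z in ball j (6 * s j), ψ z ∂μ‖ₑ}) := measure_mono_ae hcover
      _ ≤ ∑' j : u, μ {y ∈ ball (j : E) (6 * s j) | n * Λ <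
        ‖ψ y - ⨍ z in ball (j : E) (6 * s j), ψ z ∂μ‖ₑ} := measure_biUnion_le μ hu _
      _ ≤ ∑' j : u, 2⁻¹ ^ n * 6 ^ finrank ℝ E * μ (closedBall (j : E) (s j)) := by
        refine ENNReal.tsum_le_tsum fun j => ?_
        have h0 := hs0 j (huG j.2)
        refine (ih j (6 * s j) (by positivity)).trans (le_of_eq ?_)
        rw [measure_ball_mul _ (by norm_num), Measure.addHaar_closedBall_eq_addHaar_ball,
          ENNReal.ofReal_ofNat, mul_assoc]
      _ = 2⁻¹ ^ (n + 1) * (2 * 6 ^ finrank ℝ E * ∑' j : u, μ (closedBall (j : E) (s j))) := by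
        rw [ENNReal.tsum_mul_left, pow_succ]
        have : (2 : ℝ≥0∞)⁻¹ * 2 = 1 := ENNReal.inv_mul_cancel (by norm_num) (by norm_num)
        calc _ = 2⁻¹ ^ n * (2⁻¹ * 2) * 6 ^ finrank ℝ E * ∑' j : u, μ (closedBall (j : E) (s j)) := by
              rw [this, mul_one]
          _ = _ := by ring
      _ ≤ 2⁻¹ ^ (n + 1) * μ (ball x r) := by gcongr

/-- The constant in the `L^q` form of the John–Nirenberg inequality. -/
def johnNirenbergConst (E : Type*) [NormedAddCommGroup E] [NormedSpace ℝ E] (q : ℝ) : ℝ≥0∞ :=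
  (∑' n : ℕ, ((n : ℝ≥0∞) + 1) ^ q * 2⁻¹ ^ n) * decayConst E ^ q

/-- Replacing `q` by an integer above it leaves a polynomial times a geometric sequence. -/
lemma johnNirenbergConst_ne_top {q : ℝ} (hq : 0 ≤ q) : johnNirenbergConst E q ≠ ⊤ := by
  refine ENNReal.mul_ne_top ?_ (ENNReal.rpow_ne_top_of_nonneg hq decayConst_ne_top)
  obtain ⟨k, hk⟩ := exists_nat_ge q
  have hs : Summable fun n : ℕ => ((n : ℝ≥0) + 1) ^ k * 2⁻¹ ^ n := by
    have h1 : Summable fun n : ℕ => ((n : ℝ) ^ k * (2⁻¹ : ℝ) ^ n) :=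
      summable_pow_mul_geometric_of_norm_lt_one k (by norm_num)
    have h2 := ((summable_nat_add_iff 1).2 h1).mul_left 2
    rw [← NNReal.summable_coe]
    refine h2.congr fun n => ?_
    push_cast
    rw [pow_succ]; ring
  have ht : ∑' n : ℕ, ((((n : ℝ≥0) + 1) ^ k * 2⁻¹ ^ n : ℝ≥0) : ℝ≥0∞) ≠ ⊤ :=
    ENNReal.tsum_coe_ne_top_iff_summable.2 hs
  refine ne_top_of_le_ne_top ht (ENNReal.tsum_le_tsum fun n => ?_)
  rw [ENNReal.coe_mul, ENNReal.coe_pow, ENNReal.coe_pow, ENNReal.coe_add,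
    ENNReal.coe_inv (by norm_num)]
  gcongr
  · rw [← ENNReal.rpow_natCast]
    exact ENNReal.rpow_le_rpow_of_exponent_le (by simp) hk
  · simp

/-- **John–Nirenberg**, `L^q` form. -/
theorem OscillationBound.lintegral_rpow_le [Nontrivial E] {ψ : E → F} {N : ℝ≥0∞}
    (h : OscillationBound μ ψ N) (hN0 : N ≠ 0) (hN : N ≠ ⊤) {q : ℝ} (hq : 0 < q) (x : E) {r : ℝ}
    (hr : 0 < r) :
    ∫⁻ y in ball x r, ‖ψ y - ⨍ z in ball x r, ψ z ∂μ‖ₑ ^ q ∂μ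
      ≤ johnNirenbergConst E q * N ^ q * μ (ball x r) := by
  set c := ⨍ z in ball x r, ψ z ∂μ
  set Λ := decayConst E * N with hΛ
  have hΛt : Λ ≠ ⊤ := ENNReal.mul_ne_top decayConst_ne_top hN
  have hΛ0 : Λ ≠ 0 := by simp [hΛ, decayConst, hN0]
  have hm : AEMeasurable (fun y => ‖ψ y - c‖ₑ) (μ.restrict (ball x r)) :=
    (integrableOn_ball_sub h.locallyIntegrable c x r).aestronglyMeasurable.enorm
  have hS : ∀ n : ℕ, NullMeasurableSet {y | n * Λ < ‖ψ y - c‖ₑ} (μ.restrict (ball x r)) :=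
    fun n => nullMeasurableSet_lt aemeasurable_const hm
  calc ∫⁻ y in ball x r, ‖ψ y - c‖ₑ ^ q ∂μ
      ≤ ∫⁻ y in ball x r, ∑' n : ℕ, {y | n * Λ < ‖ψ y - c‖ₑ}.indicator
          (fun _ => (((n : ℝ≥0∞) + 1) * Λ) ^ q) y ∂μ := by
        refine lintegral_mono fun y => ?_
        by_cases hy : ‖ψ y - c‖ₑ = 0
        · simp [hy, hq]
        classical
        have hex : ∃ k : ℕ, ‖ψ y - c‖ₑ ≤ k * Λ := by
          obtain ⟨k, hk⟩ := ENNReal.exists_nat_mul_gt hΛ0 (enorm_ne_top (x := ψ y - c))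
          exact ⟨k, hk.le⟩
        obtain ⟨m, hm⟩ := Nat.exists_eq_succ_of_ne_zero (n := Nat.find hex) (by
          intro h0
          have := Nat.find_spec hex
          rw [h0] at this
          simp at this
          exact hy (by simpa using this))
        have h1 := Nat.find_spec hex
        rw [hm] at h1
        have h2 : m * Λ < ‖ψ y - c‖ₑ := not_le.1 (Nat.find_min hex (by omega))
        -- A single layer suffices: `m * Λ < ‖ψ y - c‖ₑ ≤ (m + 1) * Λ`.
        refine le_trans ?_ (ENNReal.le_tsum m)
        rw [indicator_of_mem (by exact h2)]
        gcongr
        simpa using h1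
    _ = ∑' n : ℕ, (((n : ℝ≥0∞) + 1) * Λ) ^ q * (μ.restrict (ball x r)) {y | n * Λ < ‖ψ y - c‖ₑ} := by
        rw [lintegral_tsum fun n => aemeasurable_const.indicator₀ (hS n)]
        congr 1; ext n
        rw [lintegral_indicator_const₀ (hS n)]
    _ ≤ ∑' n : ℕ, (((n : ℝ≥0∞) + 1) * Λ) ^ q * (2⁻¹ ^ n * μ (ball x r)) := by
        refine ENNReal.tsum_le_tsum fun n => ?_
        gcongr
        rw [Measure.restrict_apply₀ (hS n), inter_comm]
        exact h.measure_lt_enorm_le hN0 hN n x r hr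
    _ = _ := by
        rw [johnNirenbergConst, ← ENNReal.tsum_mul_right, ← ENNReal.tsum_mul_right,
          ← ENNReal.tsum_mul_right]
        congr 1; ext n
        rw [hΛ, ENNReal.mul_rpow_of_nonneg _ _ hq.le, ENNReal.mul_rpow_of_nonneg _ _ hq.le]
        ring

end JohnNirenberg

/-! ### Integrability of BMO functions against power weights. -/

noncomputable section Tail

variable {E F : Type*} [NormedAddCommGroup E] [NormedSpace ℝ E] [FiniteDimensional ℝ E]
  [MeasurableSpace E] [BorelSpace E] {μ : Measure E} [μ.IsAddHaarMeasure]
  [NormedAddCommGroup F] [NormedSpace ℝ F] [CompleteSpace F]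

/-- Telescoping: each doubling of the radius moves the mean by at most `N * 2 ^ dim`. This is the
logarithmic growth of BMO functions. -/
lemma OscillationBound.enorm_setAverage_two_pow_sub_le {ψ : E → F} {N : ℝ≥0∞}
    (h : OscillationBound μ ψ N) (x : E) {R : ℝ} (hR : 0 < R) (k : ℕ) :
    ‖(⨍ z in ball x (2 ^ k * R), ψ z ∂μ) - ⨍ z in ball x R, ψ z ∂μ‖ₑ
      ≤ k * (N * 2 ^ finrank ℝ E) := by
  induction k with
  | zero => simp
  | succ k ih =>
    have h1 := h.enorm_setAverage_sub_le x (r := 2 ^ k * R) (K := 2) (by positivity) one_le_two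
    rw [← mul_assoc, ← pow_succ', ENNReal.ofReal_ofNat] at h1
    push_cast
    rw [add_mul, one_mul]
    refine le_trans ?_ (add_le_add ih h1)
    rw [← edist_eq_enorm_sub, ← edist_eq_enorm_sub, ← edist_eq_enorm_sub, add_comm, edist_comm]
    rw [edist_comm (⨍ z in ball x (2 ^ k * R), ψ z ∂μ) (⨍ z in ball x R, ψ z ∂μ),
      add_comm]
    exact edist_triangle _ _ _

lemma OscillationBound.lintegral_two_pow_le {ψ : E → F} {N : ℝ≥0∞}
    (h : OscillationBound μ ψ N) (x : E) {R : ℝ} (hR : 0 < R) (k : ℕ) :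
    ∫⁻ y in ball x (2 ^ k * R), ‖ψ y - ⨍ z in ball x R, ψ z ∂μ‖ₑ ∂μ
      ≤ N * (1 + k * 2 ^ finrank ℝ E) * (2 ^ finrank ℝ E) ^ k * μ (ball x R) := by
  calc ∫⁻ y in ball x (2 ^ k * R), ‖ψ y - ⨍ z in ball x R, ψ z ∂μ‖ₑ ∂μ
      ≤ ∫⁻ y in ball x (2 ^ k * R), (‖ψ y - ⨍ z in ball x (2 ^ k * R), ψ z ∂μ‖ₑ
          + ‖(⨍ z in ball x (2 ^ k * R), ψ z ∂μ) - ⨍ z in ball x R, ψ z ∂μ‖ₑ) ∂μ := by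
        refine lintegral_mono fun y => ?_
        rw [← edist_eq_enorm_sub, ← edist_eq_enorm_sub, ← edist_eq_enorm_sub]
        exact edist_triangle _ _ _
    _ ≤ N * μ (ball x (2 ^ k * R)) + k * (N * 2 ^ finrank ℝ E) * μ (ball x (2 ^ k * R)) := by
        rw [lintegral_add_right _ measurable_const, setLIntegral_const]
        gcongr
        · exact h.lintegral_le x _ (by positivity)
        · exact h.enorm_setAverage_two_pow_sub_le x hR k
    _ = _ := by
        rw [measure_ball_mul x (by positivity : (0 : ℝ) < 2 ^ k), ENNReal.ofReal_pow (by norm_num),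
          ENNReal.ofReal_ofNat, ← pow_mul, ← pow_mul, mul_comm k]
        ring

/-- The constant in the weighted tail estimate `OscillationBound.lintegral_weight_le`. -/
def tailConst (μ : Measure E) (s R : ℝ) : ℝ≥0∞ :=
  (1 + ∑' k : ℕ, ENNReal.ofReal (2 ^ (-s)) ^ k *
    ((1 + (k + 1) * 2 ^ finrank ℝ E) * (2 ^ finrank ℝ E) ^ (k + 1))) * μ (ball 0 R)

/-- Linear drift times volume growth times weight gives a series with terms of order `k * 2 ^ (k *
(dim - s))`, convergent because `dim < s`. -/
lemma tailConst_ne_top {s R : ℝ} (hs : finrank ℝ E < s) : tailConst μ s R ≠ ⊤ := by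
  refine ENNReal.mul_ne_top (ENNReal.add_ne_top.2 ⟨by simp, ?_⟩) measure_ball_lt_top.ne
  set D : ℝ := 2 ^ finrank ℝ E with hD
  have hD0 : 0 < D := by positivity
  have hθ0 : 0 ≤ (2 : ℝ) ^ (-s) * D := by positivity
  have hθ : (2 : ℝ) ^ (-s) * D < 1 := by
    rw [hD, ← Real.rpow_natCast, ← Real.rpow_add (by norm_num)]
    exact Real.rpow_lt_one_of_one_lt_of_neg (by norm_num) (by linarith)
  have h1 := summable_pow_mul_geometric_of_norm_lt_one 1 (r := (2 : ℝ) ^ (-s) * D)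
    (by rwa [Real.norm_of_nonneg hθ0])
  have h0 := summable_geometric_of_lt_one hθ0 hθ
  have hsum : Summable fun k : ℕ => (2 ^ (-s)) ^ k * ((1 + ((k : ℝ) + 1) * D) * D ^ (k + 1)) := by
    refine ((h0.mul_left (D + D * D)).add (h1.mul_left (D * D))).congr fun k => ?_
    rw [mul_pow, pow_succ]; ring
  have := hsum.tsum_ofReal_ne_top
  refine ne_top_of_le_ne_top this (ENNReal.tsum_le_tsum fun k => le_of_eq ?_)
  have hD' : ENNReal.ofReal D = 2 ^ finrank ℝ E := by
    rw [hD, ENNReal.ofReal_pow (by norm_num), ENNReal.ofReal_ofNat]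
  rw [ENNReal.ofReal_mul (by positivity), ENNReal.ofReal_mul (by positivity),
    ENNReal.ofReal_pow (by positivity), ENNReal.ofReal_pow hD0.le,
    ENNReal.ofReal_add (by norm_num) (by positivity), ENNReal.ofReal_mul (by positivity), hD',
    ENNReal.ofReal_one, ENNReal.ofReal_add (by positivity) (by norm_num), ENNReal.ofReal_natCast,
    ENNReal.ofReal_one]

/-- A function of bounded mean oscillation is integrable against `(1 + ‖x‖)^(-s)`, `s > dim E`. -/
theorem OscillationBound.lintegral_weight_le {ψ : E → F} {N : ℝ≥0∞}
    (h : OscillationBound μ ψ N) {s R : ℝ} (hs : 0 ≤ s) (hR : 1 ≤ R) :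
    ∫⁻ y, ‖ψ y - ⨍ z in ball 0 R, ψ z ∂μ‖ₑ * ENNReal.ofReal ((1 + ‖y‖) ^ (-s)) ∂μ
      ≤ tailConst μ s R * N := by
  have hR0 : 0 < R := by linarith
  set u : E → ℝ≥0∞ := fun y => ‖ψ y - ⨍ z in ball 0 R, ψ z ∂μ‖ₑ with hu
  set θ := ENNReal.ofReal (2 ^ (-s))
  have hw : ∀ (k : ℕ) (y : E), 2 ^ k ≤ 1 + ‖y‖ → ENNReal.ofReal ((1 + ‖y‖) ^ (-s)) ≤ θ ^ k := by
    intro k y hy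
    rw [← ENNReal.ofReal_pow (by positivity)]
    refine ENNReal.ofReal_le_ofReal ((Real.rpow_le_rpow_of_nonpos (by positivity) hy
      (by linarith)).trans (le_of_eq ?_))
    rw [← Real.rpow_natCast, ← Real.rpow_natCast, ← Real.rpow_mul (by norm_num),
      ← Real.rpow_mul (by norm_num), mul_comm]
  -- Decomposition into the ball and dyadic annuli. Since `1 ≤ R`, the weight on the `k`-th annulus
  -- is at most `2 ^ (-s * k)`.
  have hcov : (univ : Set E) ⊆ ball 0 R ∪ ⋃ k : ℕ, ball 0 (2 ^ (k + 1) * R) \ ball 0 (2 ^ k * R) := by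
    intro y _
    by_cases hy : y ∈ ball 0 R
    · exact Or.inl hy
    right
    classical
    have hex : ∃ k : ℕ, y ∈ ball (0 : E) (2 ^ k * R) := by
      obtain ⟨k, hk⟩ := pow_unbounded_of_one_lt ‖y‖ (one_lt_two)
      refine ⟨k, mem_ball_zero_iff.2 (hk.trans_le ?_)⟩
      exact le_mul_of_one_le_right (by positivity) hR
    obtain ⟨m, hm⟩ := Nat.exists_eq_succ_of_ne_zero (n := Nat.find hex) (by
      intro h0
      have := Nat.find_spec hex
      rw [h0] at this
      exact hy (by simpa using this))
    refine mem_iUnion.2 ⟨m, ?_, Nat.find_min hex (by omega)⟩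
    have := Nat.find_spec hex
    rwa [hm] at this
  calc ∫⁻ y, u y * ENNReal.ofReal ((1 + ‖y‖) ^ (-s)) ∂μ
      ≤ ∫⁻ y in ball 0 R ∪ ⋃ k : ℕ, ball 0 (2 ^ (k + 1) * R) \ ball 0 (2 ^ k * R),
          u y * ENNReal.ofReal ((1 + ‖y‖) ^ (-s)) ∂μ := by
        rw [← setLIntegral_univ]; exact lintegral_mono_set hcov
    _ ≤ ∫⁻ y in ball 0 R, u y * ENNReal.ofReal ((1 + ‖y‖) ^ (-s)) ∂μ
        + ∑' k : ℕ, ∫⁻ y in ball 0 (2 ^ (k + 1) * R) \ ball 0 (2 ^ k * R),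
          u y * ENNReal.ofReal ((1 + ‖y‖) ^ (-s)) ∂μ :=
        (lintegral_union_le _ _ _).trans (by gcongr; exact lintegral_iUnion_le _ _)
    _ ≤ N * μ (ball 0 R) + ∑' k : ℕ, θ ^ k *
          (N * (1 + (k + 1) * 2 ^ finrank ℝ E) * (2 ^ finrank ℝ E) ^ (k + 1) * μ (ball 0 R)) := by
        gcongr with k
        · refine le_trans (lintegral_mono fun y => ?_) (h.lintegral_le 0 R hR0)
          refine mul_le_of_le_one_right (by positivity) ?_
          simpa using hw 0 y (by simp)
        · have hms : MeasurableSet (ball (0 : E) (2 ^ (k + 1) * R) \ ball 0 (2 ^ k * R)) :=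
            measurableSet_ball.diff measurableSet_ball
          calc _ ≤ ∫⁻ y in ball 0 (2 ^ (k + 1) * R) \ ball 0 (2 ^ k * R), u y * θ ^ k ∂μ := by
                refine setLIntegral_mono' hms fun y hy => ?_
                gcongr
                refine hw k y ?_
                have h1 : 2 ^ k * R ≤ ‖y‖ := not_lt.1 fun h => hy.2 (mem_ball_zero_iff.2 h)
                nlinarith [pow_pos (zero_lt_two' ℝ) k]
            _ ≤ ∫⁻ y in ball 0 (2 ^ (k + 1) * R), u y * θ ^ k ∂μ := lintegral_mono_set sdiff_subset
            _ = θ ^ k * ∫⁻ y in ball 0 (2 ^ (k + 1) * R), u y ∂μ := by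
                rw [lintegral_mul_const' _ _ (by finiteness), mul_comm]
            _ ≤ _ := by
                gcongr
                simpa using h.lintegral_two_pow_le 0 hR0 (k + 1)
    _ = tailConst μ s R * N := by
        rw [tailConst, add_mul, add_mul, one_mul, mul_comm N, ← ENNReal.tsum_mul_right,
          ← ENNReal.tsum_mul_right]
        congr 2; ext k; ring

end Tail

/-! ### Pointwise bounds, decay and cancellation for the fractional Laplacian. -/

noncomputable section FracLaplacian

variable {d : ℕ} {F : Type*} [NormedAddCommGroup F] [NormedSpace ℝ F] {γ : ℝ}

/-- Up to a constant factor, a bound for the integrand of the fractional Laplacian of a bounded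
Lipschitz function. -/
def majorant (d : ℕ) (γ : ℝ) (z : EuclideanSpace ℝ (Fin d)) : ℝ :=
  min ‖z‖ 1 * (‖z‖ ^ ((d : ℝ) + γ))⁻¹

lemma majorant_nonneg (z : EuclideanSpace ℝ (Fin d)) : 0 ≤ majorant d γ z := by
  unfold majorant; positivity

/-- In polar coordinates the radial integrand is `r ^ (-γ)` on `(0, 1]` and `r ^ (-1 - γ)` beyond,
so `γ < 1` handles the origin and `0 < γ` handles infinity. -/
lemma integrable_majorant (hd : 1 ≤ d) (hγ0 : 0 < γ) (hγ1 : γ < 1) :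
    Integrable (majorant d γ) := by
  have : Nonempty (Fin d) := ⟨⟨0, hd⟩⟩
  have hdim : finrank ℝ (EuclideanSpace ℝ (Fin d)) = d := by simp
  have key := integrable_fun_norm_addHaar (E := EuclideanSpace ℝ (Fin d)) volume
    (f := fun y : ℝ => min y 1 * (y ^ ((d : ℝ) + γ))⁻¹)
  refine key.2 ?_
  rw [hdim, ← Ioc_union_Ioi_eq_Ioi (zero_le_one' ℝ)]
  have hpow : ∀ y : ℝ, 0 < y → y ^ (d - 1) = y ^ ((d : ℝ) - 1) := fun y hy => by
    rw [← Real.rpow_natCast, Nat.cast_sub hd, Nat.cast_one]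
  refine IntegrableOn.union ?_ ?_
  · have h1 : IntegrableOn (fun y : ℝ => y ^ (-γ)) (Ioc 0 1) :=
      (intervalIntegrable_iff_integrableOn_Ioc_of_le zero_le_one).1
        (intervalIntegral.intervalIntegrable_rpow' (by linarith))
    refine h1.congr_fun (fun y hy => ?_) measurableSet_Ioc
    have hy0 : 0 < y := hy.1
    simp only [smul_eq_mul]
    rw [min_eq_left hy.2, hpow y hy0, ← Real.rpow_neg hy0.le]
    nth_rw 3 [← Real.rpow_one y]
    rw [← Real.rpow_add hy0, ← Real.rpow_add hy0]
    congr 1; ring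
  · have h1 : IntegrableOn (fun y : ℝ => y ^ (-1 - γ)) (Ioi 1) :=
      integrableOn_Ioi_rpow_of_lt (by linarith) one_pos
    refine h1.congr_fun (fun y hy => ?_) measurableSet_Ioi
    have hy1 : 1 < y := hy
    have hy0 : 0 < y := by linarith
    simp only [smul_eq_mul]
    rw [min_eq_right hy1.le, hpow y hy0, ← Real.rpow_neg hy0.le, one_mul, ← Real.rpow_add hy0]
    congr 1; ring

/-- `g` is bounded and Lipschitz at constant `K`, and vanishes outside the ball of radius `ρ`. -/
structure BddLipschitz (g : EuclideanSpace ℝ (Fin d) → F) (K ρ : ℝ) : Prop where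
  norm_sub_le : ∀ x y, ‖g x - g y‖ ≤ K * min ‖x - y‖ 1
  eq_zero : ∀ x, ρ < ‖x‖ → g x = 0

namespace BddLipschitz

variable {g : EuclideanSpace ℝ (Fin d) → F} {K ρ : ℝ}

lemma nonneg (hd : 1 ≤ d) (hg : BddLipschitz g K ρ) : 0 ≤ K := by
  have : Nonempty (Fin d) := ⟨⟨0, hd⟩⟩
  obtain ⟨x, hx⟩ := exists_ne (0 : EuclideanSpace ℝ (Fin d))
  have h := (norm_nonneg _).trans (hg.norm_sub_le x 0)
  rw [sub_zero] at h
  exact nonneg_of_mul_nonneg_left h (lt_min (norm_pos_iff.2 hx) one_pos)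

lemma continuous (hd : 1 ≤ d) (hg : BddLipschitz g K ρ) : Continuous g := by
  refine (LipschitzWith.of_dist_le_mul (K := ⟨K, hg.nonneg hd⟩) fun x y => ?_).continuous
  rw [dist_eq_norm, dist_eq_norm]
  exact (hg.norm_sub_le x y).trans (mul_le_mul_of_nonneg_left (min_le_left _ _) (hg.nonneg hd))

lemma norm_le (hd : 1 ≤ d) (hg : BddLipschitz g K ρ) (x : EuclideanSpace ℝ (Fin d)) :
    ‖g x‖ ≤ K := by
  have : Nonempty (Fin d) := ⟨⟨0, hd⟩⟩
  obtain ⟨y, hy⟩ := NormedSpace.exists_lt_norm ℝ (EuclideanSpace ℝ (Fin d)) ρ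
  have h := hg.norm_sub_le x y
  rw [hg.eq_zero y hy, sub_zero] at h
  exact h.trans (mul_le_of_le_one_right (hg.nonneg hd) (min_le_right _ _))

lemma hasCompactSupport (hg : BddLipschitz g K ρ) : HasCompactSupport g :=
  HasCompactSupport.intro (isCompact_closedBall 0 ρ) fun x hx =>
    hg.eq_zero x (by simpa using hx)

lemma integrable (hd : 1 ≤ d) (hg : BddLipschitz g K ρ) : Integrable g :=
  (hg.continuous hd).integrable_of_hasCompactSupport hg.hasCompactSupport

lemma norm_integrand_le (hg : BddLipschitz g K ρ) (x y : EuclideanSpace ℝ (Fin d)) :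
    ‖(‖x - y‖ ^ ((d : ℝ) + γ))⁻¹ • (g x - g y)‖ ≤ K * majorant d γ (x - y) := by
  rw [norm_smul, Real.norm_of_nonneg (by positivity), majorant, ← mul_assoc, mul_comm]
  exact mul_le_mul_of_nonneg_right (hg.norm_sub_le x y) (by positivity)

lemma stronglyMeasurable_integrand (hd : 1 ≤ d) (hg : BddLipschitz g K ρ) :
    StronglyMeasurable fun z : EuclideanSpace ℝ (Fin d) × EuclideanSpace ℝ (Fin d) =>
      (‖z.1 - z.2‖ ^ ((d : ℝ) + γ))⁻¹ • (g z.1 - g z.2) := by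
  have h1 : Measurable fun z : EuclideanSpace ℝ (Fin d) × EuclideanSpace ℝ (Fin d) =>
      (‖z.1 - z.2‖ ^ ((d : ℝ) + γ))⁻¹ := by fun_prop
  have h2 : Continuous fun z : EuclideanSpace ℝ (Fin d) × EuclideanSpace ℝ (Fin d) =>
      g z.1 - g z.2 := by
    have := hg.continuous hd
    fun_prop
  exact h1.stronglyMeasurable.smul h2.stronglyMeasurable

lemma integrable_integrand (hd : 1 ≤ d) (hγ0 : 0 < γ) (hγ1 : γ < 1) (hg : BddLipschitz g K ρ)
    (x : EuclideanSpace ℝ (Fin d)) :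
    Integrable fun y => (‖x - y‖ ^ ((d : ℝ) + γ))⁻¹ • (g x - g y) := by
  refine Integrable.mono' (((integrable_majorant hd hγ0 hγ1).comp_sub_left x).const_mul K) ?_
    (Eventually.of_forall fun y => hg.norm_integrand_le x y)
  exact ((hg.stronglyMeasurable_integrand hd).comp_measurable
    measurable_prodMk_left).aestronglyMeasurable

lemma norm_fracLaplacian_le (hd : 1 ≤ d) (hγ0 : 0 < γ) (hγ1 : γ < 1) (hg : BddLipschitz g K ρ)
    (x : EuclideanSpace ℝ (Fin d)) :
    ‖fracLaplacian γ g x‖ ≤ |fracConst d γ| * (K * ∫ z, majorant d γ z) := by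
  rw [fracLaplacian, norm_smul, Real.norm_eq_abs]
  gcongr
  refine (norm_integral_le_of_norm_le
    (((integrable_majorant hd hγ0 hγ1).comp_sub_left x).const_mul K)
    (Eventually.of_forall fun y => hg.norm_integrand_le x y)).trans (le_of_eq ?_)
  rw [integral_const_mul, integral_sub_left_eq_self (majorant d γ) volume x]

/-- At such `x` the term `g x` vanishes, and only `g y` with `‖y‖ ≤ ρ` contributes, where the kernel
is comparable to `(1 + ‖x‖) ^ (-(d + γ))`. This is the source of the `L^1` norm in the theorem. -/
lemma norm_fracLaplacian_le_of_far (hd : 1 ≤ d) (hγ0 : 0 < γ) (hg : BddLipschitz g K ρ)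
    (hρ : 1 ≤ ρ) {x : EuclideanSpace ℝ (Fin d)} (hx : 2 * ρ ≤ ‖x‖) :
    ‖fracLaplacian γ g x‖
      ≤ |fracConst d γ| * (4 ^ ((d : ℝ) + γ) * ∫ y, ‖g y‖) * (1 + ‖x‖) ^ (-((d : ℝ) + γ)) := by
  have hs : 0 ≤ (d : ℝ) + γ := by positivity
  rw [fracLaplacian, norm_smul, Real.norm_eq_abs, mul_assoc]
  gcongr
  refine (norm_integral_le_of_norm_le (g := fun y =>
    4 ^ ((d : ℝ) + γ) * (1 + ‖x‖) ^ (-((d : ℝ) + γ)) * ‖g y‖)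
    ((hg.integrable hd).norm.const_mul _) (Eventually.of_forall fun y => ?_)).trans (le_of_eq ?_)
  · rw [hg.eq_zero x (by linarith), zero_sub, norm_smul, norm_neg]
    by_cases hy : ρ < ‖y‖
    · simp [hg.eq_zero y hy]
    gcongr
    have h1 : ‖x‖ - ‖y‖ ≤ ‖x - y‖ := norm_sub_norm_le x y
    -- From `‖y‖ ≤ ρ ≤ ‖x‖ / 2` and `1 ≤ ρ`.
    have h2 : (1 + ‖x‖) / 4 ≤ ‖x - y‖ := by linarith
    rw [Real.norm_of_nonneg (by positivity), ← Real.rpow_neg (norm_nonneg _)]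
    calc ‖x - y‖ ^ (-((d : ℝ) + γ)) ≤ ((1 + ‖x‖) / 4) ^ (-((d : ℝ) + γ)) :=
          Real.rpow_le_rpow_of_nonpos (by positivity) h2 (by linarith)
      _ = _ := by
          rw [Real.div_rpow (by positivity) (by norm_num), Real.rpow_neg (by norm_num : (0:ℝ) ≤ 4)]
          field_simp
  · rw [integral_const_mul]; ring

/-- The fractional Laplacian of a compactly supported Lipschitz function decays like
`(1 + ‖x‖)^(-(d + γ))`. -/
lemma exists_norm_fracLaplacian_le (hd : 1 ≤ d) (hγ0 : 0 < γ) (hγ1 : γ < 1) (K ρ : ℝ)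
    (hρ : 1 ≤ ρ) :
    ∃ B : ℝ, ∀ g : EuclideanSpace ℝ (Fin d) → F, BddLipschitz g K ρ → ∀ x,
      ‖fracLaplacian γ g x‖ ≤ B * (1 + ‖x‖) ^ (-((d : ℝ) + γ)) := by
  have hs : 0 ≤ (d : ℝ) + γ := by positivity
  -- `B1` serves `‖x‖ < 2 * ρ`, where the weight is bounded below; `B2` serves the far region.
  -- Neither depends on `g`, so one bound covers a whole sequence of mollifications.
  set B1 := |fracConst d γ| * (K * ∫ z, majorant d γ z) * (1 + 2 * ρ) ^ ((d : ℝ) + γ)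
  set B2 := |fracConst d γ| * (4 ^ ((d : ℝ) + γ) *
    (K * volume.real (closedBall (0 : EuclideanSpace ℝ (Fin d)) ρ)))
  refine ⟨max B1 B2, fun g hg x => ?_⟩
  have hJ : 0 ≤ ∫ z, majorant d γ z := integral_nonneg majorant_nonneg
  have hK := hg.nonneg hd
  by_cases hx : 2 * ρ ≤ ‖x‖
  · refine (hg.norm_fracLaplacian_le_of_far hd hγ0 hρ hx).trans ?_
    gcongr
    refine le_trans ?_ (le_max_right B1 B2)
    simp only [B2]
    gcongr
    calc ∫ y, ‖g y‖ = ∫ y in closedBall 0 ρ, ‖g y‖ := by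
          refine (setIntegral_eq_integral_of_forall_compl_eq_zero fun y hy => ?_).symm
          rw [hg.eq_zero y (by simpa using hy), norm_zero]
      _ ≤ ∫ y in closedBall (0 : EuclideanSpace ℝ (Fin d)) ρ, K :=
          setIntegral_mono (hg.integrable hd).norm.integrableOn
            (integrableOn_const measure_closedBall_lt_top.ne) fun y => hg.norm_le hd y
      _ = _ := by rw [setIntegral_const, smul_eq_mul, mul_comm]
  · refine (hg.norm_fracLaplacian_le hd hγ0 hγ1 x).trans ?_
    refine le_trans ?_ (mul_le_mul_of_nonneg_right (le_max_left B1 B2) (by positivity))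
    simp only [B1]
    rw [mul_assoc (|fracConst d γ| * _)]
    refine le_mul_of_one_le_right (by positivity) ?_
    rw [Real.rpow_neg (by positivity), ← div_eq_mul_inv, one_le_div (by positivity)]
    exact Real.rpow_le_rpow (by positivity) (by linarith) hs

lemma stronglyMeasurable_fracLaplacian (hd : 1 ≤ d) (hg : BddLipschitz g K ρ) :
    StronglyMeasurable (fracLaplacian γ g) := by
  have := (hg.stronglyMeasurable_integrand (γ := γ) hd).integral_prod_right' (ν := volume)
  exact this.const_smul (fracConst d γ)

/-- The decay weight is integrable and at most 1, so its `p`-th power is dominated by the weight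
itself. -/
lemma memLp_fracLaplacian (hd : 1 ≤ d) (hγ0 : 0 < γ) (hγ1 : γ < 1) (hg : BddLipschitz g K ρ)
    (hρ : 1 ≤ ρ) {p : ℝ} (hp : 1 ≤ p) : MemLp (fracLaplacian γ g) (ENNReal.ofReal p) := by
  obtain ⟨B, hB⟩ := exists_norm_fracLaplacian_le (F := F) hd hγ0 hγ1 K ρ hρ
  have hs : 0 ≤ (d : ℝ) + γ := by positivity
  have hw : MemLp (fun x : EuclideanSpace ℝ (Fin d) => (1 + ‖x‖) ^ (-((d : ℝ) + γ)))
      (ENNReal.ofReal p) := by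
    have hp0 : ENNReal.ofReal p ≠ 0 := by simp; linarith
    rw [← integrable_norm_rpow_iff (Measurable.aestronglyMeasurable (by fun_prop)) hp0
      ENNReal.ofReal_ne_top, ENNReal.toReal_ofReal (by linarith)]
    refine (integrable_one_add_norm (E := EuclideanSpace ℝ (Fin d)) (μ := volume)
      (r := (d : ℝ) + γ) (by simpa using hγ0)).mono'
      (Measurable.aestronglyMeasurable (by fun_prop)) (Eventually.of_forall fun x => ?_)
    have h1 : (1 + ‖x‖) ^ (-((d : ℝ) + γ)) ≤ 1 :=
      Real.rpow_le_one_of_one_le_of_nonpos (by simp) (by linarith)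
    have h0 : 0 ≤ (1 + ‖x‖) ^ (-((d : ℝ) + γ)) := by positivity
    rw [Real.norm_of_nonneg (by positivity), Real.norm_of_nonneg h0]
    exact Real.rpow_le_self_of_le_one h0 h1 hp
  exact hw.of_le_mul (hg.stronglyMeasurable_fracLaplacian hd).aestronglyMeasurable (c := B)
    (Eventually.of_forall fun x => by
      rw [Real.norm_of_nonneg (by positivity)]; exact hB g hg x)

/-- The integrand is antisymmetric in `(x, y)`, so Fubini makes the double integral equal to its
negative. Fubini applies since the integrand vanishes unless `x` or `y` lies in the ball of radius
`ρ`, which gives the majorant `K * (χ x + χ y) * majorant d γ (x - y)`. -/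
lemma integral_fracLaplacian_eq_zero (hd : 1 ≤ d) (hγ0 : 0 < γ) (hγ1 : γ < 1)
    (hg : BddLipschitz g K ρ) : ∫ x, fracLaplacian γ g x = 0 := by
  set χ : EuclideanSpace ℝ (Fin d) → ℝ := (closedBall 0 ρ).indicator fun _ => 1
  have hχ : Integrable χ :=
    (integrable_indicator_iff measurableSet_closedBall).2
      (integrableOn_const measure_closedBall_lt_top.ne)
  have hχ1 : ∀ x, ¬ ρ < ‖x‖ → χ x = 1 := fun x hx =>
    indicator_of_mem (mem_closedBall_zero_iff.2 (not_lt.1 hx)) _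
  have hχ0 : ∀ x, 0 ≤ χ x := fun x => indicator_nonneg (fun _ _ => zero_le_one) x
  have hsymm : ∀ x y : EuclideanSpace ℝ (Fin d), majorant d γ (x - y) = majorant d γ (y - x) :=
    fun x y => by simp only [majorant, norm_sub_rev]
  have h1 : Integrable (fun z : EuclideanSpace ℝ (Fin d) × EuclideanSpace ℝ (Fin d) =>
      χ z.2 * majorant d γ (z.1 - z.2)) (volume.prod volume) :=
    hχ.convolution_integrand (ContinuousLinearMap.mul ℝ ℝ) (integrable_majorant hd hγ0 hγ1)
  have h2 : Integrable (fun z : EuclideanSpace ℝ (Fin d) × EuclideanSpace ℝ (Fin d) =>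
      χ z.1 * majorant d γ (z.2 - z.1)) (volume.prod volume) := h1.swap
  have hint : Integrable (Function.uncurry fun x y : EuclideanSpace ℝ (Fin d) =>
      (‖x - y‖ ^ ((d : ℝ) + γ))⁻¹ • (g x - g y)) (volume.prod volume) := by
    refine Integrable.mono' ((h1.add h2).const_mul K)
      (hg.stronglyMeasurable_integrand hd).aestronglyMeasurable
      (Eventually.of_forall fun ⟨x, y⟩ => ?_)
    have hm := majorant_nonneg (γ := γ) (x - y)
    have hK := hg.nonneg hd
    simp only [Function.uncurry_apply_pair, Pi.add_apply]
    rw [hsymm y x, ← add_mul]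
    by_cases hx : ρ < ‖x‖
    · by_cases hy : ρ < ‖y‖
      · rw [hg.eq_zero x hx, hg.eq_zero y hy]
        have := hχ0 x; have := hχ0 y
        simp only [sub_self, smul_zero, norm_zero]
        positivity
      · refine (hg.norm_integrand_le x y).trans ?_
        gcongr
        exact le_mul_of_one_le_left hm (by have := hχ1 y hy; have := hχ0 x; linarith)
    · refine (hg.norm_integrand_le x y).trans ?_
      gcongr
      exact le_mul_of_one_le_left hm (by have := hχ1 x hx; have := hχ0 y; linarith)
  have hanti : ∫ x, ∫ y, (‖x - y‖ ^ ((d : ℝ) + γ))⁻¹ • (g x - g y)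
      = -∫ x, ∫ y, (‖x - y‖ ^ ((d : ℝ) + γ))⁻¹ • (g x - g y) := by
    conv_lhs => rw [integral_integral_swap hint]
    rw [← integral_neg]
    congr 1; ext y
    rw [← integral_neg]
    congr 1; ext x
    rw [norm_sub_rev, ← smul_neg, neg_sub]
  simp only [fracLaplacian]
  rw [eq_neg_iff_add_eq_zero, ← two_smul ℝ] at hanti
  rw [integral_smul, (smul_eq_zero.1 hanti).resolve_left two_ne_zero, smul_zero]

end BddLipschitz

end FracLaplacian

/-! ### Mollification by shrinking bumps. -/

noncomputable section Mollification

open ContinuousLinearMap (lsmul)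
open scoped Convolution

/-- A sequence of bump functions shrinking to the origin. -/
def shrinkingBump (E : Type*) [NormedAddCommGroup E] (n : ℕ) : ContDiffBump (0 : E) where
  rIn := 1 / (2 * ((n : ℝ) + 1))
  rOut := 1 / ((n : ℝ) + 1)
  rIn_pos := by positivity
  rIn_lt_rOut := by
    have : (0 : ℝ) < n + 1 := by positivity
    exact one_div_lt_one_div_of_lt this (by linarith)

variable {E : Type*} [NormedAddCommGroup E] [NormedSpace ℝ E] [FiniteDimensional ℝ E]
  [MeasurableSpace E] [BorelSpace E] [HasContDiffBump E] {μ : Measure E} [μ.IsAddHaarMeasure]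
  {F : Type*} [NormedAddCommGroup F] [NormedSpace ℝ F] [CompleteSpace F]

lemma shrinkingBump_rOut_le (n : ℕ) : (shrinkingBump E n).rOut ≤ 1 := by
  simp only [shrinkingBump]
  rw [div_le_one (by positivity)]
  simp

lemma tendsto_shrinkingBump_rOut : Tendsto (fun n => (shrinkingBump E n).rOut) atTop (𝓝 0) :=
  tendsto_one_div_add_atTop_nhds_zero_nat

/-- A bounded ratio of outer to inner radius is what almost everywhere convergence of mollifications
of a merely locally integrable function requires. -/
lemma shrinkingBump_rOut_le_mul (n : ℕ) :
    (shrinkingBump E n).rOut ≤ 2 * (shrinkingBump E n).rIn := by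
  simp only [shrinkingBump]
  field_simp
  rfl

lemma contDiff_normed_convolution (b : ContDiffBump (0 : E)) {g : E → F}
    (hg : LocallyIntegrable g μ) : ContDiff ℝ ∞ (b.normed μ ⋆[lsmul ℝ ℝ, μ] g) :=
  b.hasCompactSupport_normed.contDiff_convolution_left _ b.contDiff_normed hg

lemma integrable_normed_smul_comp_sub (b : ContDiffBump (0 : E)) {g : E → F}
    (hg : LocallyIntegrable g μ) (x : E) :
    Integrable (fun t => b.normed μ t • g (x - t)) μ :=
  b.hasCompactSupport_normed.convolutionExists_left (lsmul ℝ ℝ)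
    (b.continuous_normed) hg x

end Mollification

/-! ### Extending the distributional identity to Lipschitz test functions. -/

noncomputable section Duality

open ContinuousLinearMap (lsmul)
open scoped Convolution

variable {d : ℕ} {F : Type*} [NormedAddCommGroup F] [NormedSpace ℝ F] [CompleteSpace F] {γ : ℝ}

/-- A mollification is an average of translates, so it keeps `K`; the support radius grows by at
most the bump radius. -/
lemma BddLipschitz.normed_convolution (hd : 1 ≤ d) {g : EuclideanSpace ℝ (Fin d) → F} {K ρ : ℝ}
    (hg : BddLipschitz g K ρ) (b : ContDiffBump (0 : EuclideanSpace ℝ (Fin d)))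
    (hb : b.rOut ≤ 1) :
    BddLipschitz (b.normed volume ⋆[lsmul ℝ ℝ, volume] g) K (ρ + 1) where
  norm_sub_le x y := by
    have hi := integrable_normed_smul_comp_sub (μ := volume) b
      (hg.continuous hd).locallyIntegrable
    simp only [convolution, ContinuousLinearMap.lsmul_apply]
    rw [← integral_sub (hi x) (hi y)]
    refine (norm_integral_le_of_norm_le (g := fun t => b.normed volume t * (K * min ‖x - y‖ 1))
      (b.integrable_normed.mul_const _) (Eventually.of_forall fun t => ?_)).trans (le_of_eq ?_)
    · rw [← smul_sub, norm_smul, Real.norm_of_nonneg (b.nonneg_normed t)]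
      gcongr
      · exact b.nonneg_normed t
      · simpa using hg.norm_sub_le (x - t) (y - t)
    · rw [integral_mul_const, b.integral_normed, one_mul]
  eq_zero x hx := by
    simp only [convolution, ContinuousLinearMap.lsmul_apply]
    refine integral_eq_zero_of_ae (Eventually.of_forall fun t => ?_)
    by_cases ht : t ∈ Function.support (b.normed volume)
    · rw [b.support_normed_eq, mem_ball_zero_iff] at ht
      have := norm_sub_norm_le x t
      simp [hg.eq_zero (x - t) (by linarith)]
    · simp [Function.notMem_support.1 ht]

/-- The common constant `K` supplies one dominating function, `K * majorant d γ (x - y)`, for all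
the integrands. -/
lemma tendsto_fracLaplacian (hd : 1 ≤ d) (hγ0 : 0 < γ) (hγ1 : γ < 1)
    {g : EuclideanSpace ℝ (Fin d) → F} {u : ℕ → EuclideanSpace ℝ (Fin d) → F} {K ρ : ℝ}
    (hu : ∀ n, BddLipschitz (u n) K ρ) (hlim : ∀ x, Tendsto (fun n => u n x) atTop (𝓝 (g x)))
    (x : EuclideanSpace ℝ (Fin d)) :
    Tendsto (fun n => fracLaplacian γ (u n) x) atTop (𝓝 (fracLaplacian γ g x)) := by
  refine Tendsto.const_smul ?_ _
  refine tendsto_integral_of_dominated_convergence (fun y => K * majorant d γ (x - y))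
    (fun n => ((hu n).integrable_integrand hd hγ0 hγ1 x).aestronglyMeasurable)
    (((integrable_majorant hd hγ0 hγ1).comp_sub_left x).const_mul K)
    (fun n => Eventually.of_forall fun y => (hu n).norm_integrand_le x y)
    (Eventually.of_forall fun y => ((hlim x).sub (hlim y)).const_smul _)

/-- The distributional identity `f = (-Δ)^{γ/2} ψ` may be tested against compactly supported
Lipschitz functions. -/
lemma IsFracLaplacianOf.integral_smul_eq (hd : 1 ≤ d) (hγ0 : 0 < γ) (hγ1 : γ < 1)
    {f ψ : EuclideanSpace ℝ (Fin d) → F} (hf : Continuous f) (h : IsFracLaplacianOf γ f ψ)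
    (hψm : AEStronglyMeasurable ψ)
    (hψ : Integrable fun x => (1 + ‖x‖) ^ (-((d : ℝ) + γ)) * ‖ψ x‖)
    {φ : EuclideanSpace ℝ (Fin d) → ℝ} {K ρ : ℝ} (hφ : BddLipschitz φ K ρ) (hρ : 1 ≤ ρ) :
    ∫ x, φ x • f x = ∫ x, fracLaplacian γ φ x • ψ x := by
  set u : ℕ → EuclideanSpace ℝ (Fin d) → ℝ := fun n =>
    (shrinkingBump (EuclideanSpace ℝ (Fin d)) n).normed volume ⋆[lsmul ℝ ℝ, volume] φ
  have hu : ∀ n, BddLipschitz (u n) K (ρ + 1) := fun n =>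
    hφ.normed_convolution hd _ (shrinkingBump_rOut_le n)
  have hlim : ∀ x, Tendsto (fun n => u n x) atTop (𝓝 (φ x)) := fun x =>
    ContDiffBump.convolution_tendsto_right_of_continuous tendsto_shrinkingBump_rOut
      (hφ.continuous hd) x
  have heq : ∀ n, ∫ x, u n x • f x = ∫ x, fracLaplacian γ (u n) x • ψ x := fun n =>
    h (u n) (contDiff_normed_convolution _ (hφ.continuous hd).locallyIntegrable)
      (hu n).hasCompactSupport
  -- One `B` for all mollifications: with the weighted integrability of `ψ` it gives the dominating
  -- function on the right. On the left, the common compact support is enough.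
  obtain ⟨B, hB⟩ := BddLipschitz.exists_norm_fracLaplacian_le (F := ℝ) hd hγ0 hγ1 K (ρ + 1)
    (by linarith)
  have hL : Tendsto (fun n => ∫ x, u n x • f x) atTop (𝓝 (∫ x, φ x • f x)) := by
    refine tendsto_integral_of_dominated_convergence
      ((closedBall 0 (ρ + 1)).indicator fun x => K * ‖f x‖)
      (fun n => (((hu n).continuous hd).smul hf).aestronglyMeasurable) ?_ (fun n => ?_)
      (Eventually.of_forall fun x => (hlim x).smul_const _)
    · exact (integrable_indicator_iff measurableSet_closedBall).2
        ((continuous_const.mul hf.norm).continuousOn.integrableOn_compact (isCompact_closedBall _ _))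
    · refine Eventually.of_forall fun x => ?_
      by_cases hx : x ∈ closedBall (0 : EuclideanSpace ℝ (Fin d)) (ρ + 1)
      · rw [indicator_of_mem hx, norm_smul]
        gcongr
        exact (hu n).norm_le hd x
      · rw [indicator_of_notMem hx, (hu n).eq_zero x (by simpa using hx), zero_smul, norm_zero]
  have hR : Tendsto (fun n => ∫ x, fracLaplacian γ (u n) x • ψ x) atTop
      (𝓝 (∫ x, fracLaplacian γ φ x • ψ x)) := by
    refine tendsto_integral_of_dominated_convergence
      (fun x => B * ((1 + ‖x‖) ^ (-((d : ℝ) + γ)) * ‖ψ x‖))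
      (fun n => ((hu n).stronglyMeasurable_fracLaplacian hd).aestronglyMeasurable.smul hψm)
      (hψ.const_mul B) (fun n => Eventually.of_forall fun x => ?_)
      (Eventually.of_forall fun x => (tendsto_fracLaplacian hd hγ0 hγ1 hu hlim x).smul_const _)
    rw [norm_smul, ← mul_assoc]
    gcongr
    exact hB (u n) (hu n) x
  exact tendsto_nhds_unique hL (by simpa only [heq] using hR)

end Duality

/-! ### Duality for vector-valued functions, by coordinates. -/

noncomputable section VectorDuality

variable {d : ℕ} {F : Type*} [NormedAddCommGroup F] [InnerProductSpace ℝ F]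
  [FiniteDimensional ℝ F] {γ : ℝ}

lemma BddLipschitz.inner_left {g : EuclideanSpace ℝ (Fin d) → F} {K ρ : ℝ}
    (hg : BddLipschitz g K ρ) {e : F} (he : ‖e‖ = 1) : BddLipschitz (fun x => ⟪e, g x⟫) K ρ where
  norm_sub_le x y := by
    rw [← inner_sub_right]
    refine (norm_inner_le_norm _ _).trans ?_
    rw [he, one_mul]
    exact hg.norm_sub_le x y
  eq_zero x hx := by simp [hg.eq_zero x hx]

lemma BddLipschitz.fracLaplacian_inner (hd : 1 ≤ d) (hγ0 : 0 < γ) (hγ1 : γ < 1)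
    {g : EuclideanSpace ℝ (Fin d) → F} {K ρ : ℝ} (hg : BddLipschitz g K ρ) (e : F)
    (x : EuclideanSpace ℝ (Fin d)) :
    fracLaplacian γ (fun x => ⟪e, g x⟫) x = ⟪e, fracLaplacian γ g x⟫ := by
  simp only [fracLaplacian]
  rw [inner_smul_right, ← integral_inner (hg.integrable_integrand hd hγ0 hγ1 x)]
  simp only [inner_smul_right, inner_sub_right, smul_eq_mul]

lemma BddLipschitz.integrable_smul (hd : 1 ≤ d) {φ : EuclideanSpace ℝ (Fin d) → ℝ} {K ρ : ℝ}
    (hφ : BddLipschitz φ K ρ) {f : EuclideanSpace ℝ (Fin d) → F} (hf : Continuous f) :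
    Integrable fun x => φ x • f x :=
  ((hφ.continuous hd).smul hf).integrable_of_hasCompactSupport hφ.hasCompactSupport.smul_right

lemma integrable_smul_of_le_weight {h : EuclideanSpace ℝ (Fin d) → ℝ}
    {ψ : EuclideanSpace ℝ (Fin d) → F} {B : ℝ} (hh : AEStronglyMeasurable h)
    (hB : ∀ x, ‖h x‖ ≤ B * (1 + ‖x‖) ^ (-((d : ℝ) + γ))) (hψm : AEStronglyMeasurable ψ)
    (hψ : Integrable fun x => (1 + ‖x‖) ^ (-((d : ℝ) + γ)) * ‖ψ x‖) :
    Integrable fun x => h x • ψ x := by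
  refine (hψ.const_mul B).mono' (hh.smul hψm) (Eventually.of_forall fun x => ?_)
  rw [norm_smul, ← mul_assoc]
  gcongr
  exact hB x

/-- Duality for vector-valued Lipschitz test functions. -/
lemma IsFracLaplacianOf.integral_inner_eq (hd : 1 ≤ d) (hγ0 : 0 < γ) (hγ1 : γ < 1)
    {f ψ : EuclideanSpace ℝ (Fin d) → F} (hf : Continuous f) (h : IsFracLaplacianOf γ f ψ)
    (hψm : AEStronglyMeasurable ψ)
    (hψ : Integrable fun x => (1 + ‖x‖) ^ (-((d : ℝ) + γ)) * ‖ψ x‖)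
    {g : EuclideanSpace ℝ (Fin d) → F} {K ρ : ℝ} (hg : BddLipschitz g K ρ) (hρ : 1 ≤ ρ) :
    ∫ x, ⟪f x, g x⟫ = ∫ x, ⟪ψ x, fracLaplacian γ g x⟫ := by
  -- Each coordinate of `g` is a scalar test function. Pairing the resulting vector identity with
  -- the same basis vector and summing over the basis recovers the inner products.
  set b := stdOrthonormalBasis ℝ F
  have hb : ∀ i, BddLipschitz (fun x => ⟪b i, g x⟫) K ρ := fun i => hg.inner_left (b.norm_eq_one i)
  obtain ⟨B, hB⟩ := BddLipschitz.exists_norm_fracLaplacian_le (F := ℝ) hd hγ0 hγ1 K ρ hρ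
  have hi1 : ∀ i, Integrable fun x => ⟪b i, g x⟫ • f x := fun i => (hb i).integrable_smul hd hf
  have hi2 : ∀ i, Integrable fun x => fracLaplacian γ (fun x => ⟪b i, g x⟫) x • ψ x := fun i =>
    integrable_smul_of_le_weight
      ((hb i).stronglyMeasurable_fracLaplacian hd).aestronglyMeasurable (hB _ (hb i)) hψm hψ
  have key : ∀ i, ∫ x, ⟪f x, b i⟫ * ⟪b i, g x⟫ = ∫ x, ⟪ψ x, b i⟫ * ⟪b i, fracLaplacian γ g x⟫ := by
    intro i
    have h1 := congrArg (fun v => ⟪b i, v⟫) (h.integral_smul_eq hd hγ0 hγ1 hf hψm hψ (hb i) hρ)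
    rw [← integral_inner (hi1 i), ← integral_inner (hi2 i)] at h1
    simp only [inner_smul_right, hg.fracLaplacian_inner hd hγ0 hγ1] at h1
    simpa only [real_inner_comm (b i), mul_comm] using h1
  have hj1 : ∀ i, Integrable fun x => ⟪f x, b i⟫ * ⟪b i, g x⟫ := fun i => by
    have := (hi1 i).const_inner (𝕜 := ℝ) (b i)
    simpa only [inner_smul_right, real_inner_comm (b i), mul_comm] using this
  have hj2 : ∀ i, Integrable fun x => ⟪ψ x, b i⟫ * ⟪b i, fracLaplacian γ g x⟫ := fun i => by
    have := (hi2 i).const_inner (𝕜 := ℝ) (b i)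
    simpa only [inner_smul_right, real_inner_comm (b i), mul_comm,
      hg.fracLaplacian_inner hd hγ0 hγ1] using this
  have e1 : (fun x => ⟪f x, g x⟫) = fun x => ∑ i, ⟪f x, b i⟫ * ⟪b i, g x⟫ :=
    funext fun x => (b.sum_inner_mul_inner _ _).symm
  have e2 : (fun x => ⟪ψ x, fracLaplacian γ g x⟫)
      = fun x => ∑ i, ⟪ψ x, b i⟫ * ⟪b i, fracLaplacian γ g x⟫ :=
    funext fun x => (b.sum_inner_mul_inner _ _).symm
  rw [e1, e2, integral_finsetSum _ fun i _ => hj1 i, integral_finsetSum _ fun i _ => hj2 i]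
  exact Finset.sum_congr rfl fun i _ => key i

end VectorDuality

/-! ### Lipschitz representatives of `W^{1,∞}` functions. -/

noncomputable section LipschitzRepresentative

open ContinuousLinearMap (lsmul)
open scoped Convolution

variable {d : ℕ} {F : Type*} [NormedAddCommGroup F] [NormedSpace ℝ F] {γ : ℝ}

/-- The derivative of a mollification in terms of the weak derivative. -/
lemma fderiv_normed_convolution_apply [CompleteSpace F] {g : EuclideanSpace ℝ (Fin d) → F}
    {G : EuclideanSpace ℝ (Fin d) → EuclideanSpace ℝ (Fin d) →L[ℝ] F} (hg : LocallyIntegrable g)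
    (hG : ∀ φ : EuclideanSpace ℝ (Fin d) → ℝ, ContDiff ℝ ∞ φ → HasCompactSupport φ →
      ∀ v, ∫ x, (fderiv ℝ φ x v) • g x = - ∫ x, φ x • G x v)
    (b : ContDiffBump (0 : EuclideanSpace ℝ (Fin d))) (x v : EuclideanSpace ℝ (Fin d)) :
    fderiv ℝ (b.normed volume ⋆[lsmul ℝ ℝ, volume] g) x v
      = ∫ t, b.normed volume (x - t) • G t v := by
  have hη : ContDiff ℝ 1 (b.normed volume) := b.contDiff_normed
  have hD := b.hasCompactSupport_normed.hasFDerivAt_convolution_left (lsmul ℝ ℝ) hη hg x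
  have hi := (b.hasCompactSupport_normed.fderiv ℝ).convolutionExists_left
    ((lsmul ℝ ℝ : ℝ →L[ℝ] F →L[ℝ] F).precompL (EuclideanSpace ℝ (Fin d)))
    (hη.continuous_fderiv one_ne_zero) hg x
  rw [hD.fderiv, convolution, ContinuousLinearMap.integral_apply hi]
  simp only [ContinuousLinearMap.precompL_apply, ContinuousLinearMap.lsmul_apply]
  -- The reflected, translated bump is the test function; the sign from the reflection cancels the
  -- sign in the definition of the weak derivative.
  set φ : EuclideanSpace ℝ (Fin d) → ℝ := fun t => b.normed volume (x - t)
  have hφ : ContDiff ℝ ∞ φ := b.contDiff_normed.comp (contDiff_const.sub contDiff_id)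
  have hφc : HasCompactSupport φ :=
    b.hasCompactSupport_normed.comp_homeomorph (Homeomorph.subLeft x)
  have hφ' : ∀ t, fderiv ℝ φ t v = -fderiv ℝ (b.normed volume) (x - t) v := fun t => by
    have h1 : HasFDerivAt φ _ t := ((hη.differentiable one_ne_zero) (x - t)).hasFDerivAt.comp t
      ((hasFDerivAt_id t).const_sub x)
    rw [h1.fderiv]
    simp
  rw [← integral_sub_left_eq_self (fun t => fderiv ℝ (b.normed volume) t v • g (x - t)) volume x]
  have := hG φ hφ hφc v
  simp only [hφ', neg_smul, integral_neg, neg_inj] at this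
  simpa using this

/-- Mollifications of a `W^{1,∞}` function are Lipschitz, uniformly in the mollification. -/
lemma norm_normed_convolution_sub_le [CompleteSpace F] {g : EuclideanSpace ℝ (Fin d) → F}
    {G : EuclideanSpace ℝ (Fin d) → EuclideanSpace ℝ (Fin d) →L[ℝ] F} (hg : LocallyIntegrable g)
    (hG : ∀ φ : EuclideanSpace ℝ (Fin d) → ℝ, ContDiff ℝ ∞ φ → HasCompactSupport φ →
      ∀ v, ∫ x, (fderiv ℝ φ x v) • g x = - ∫ x, φ x • G x v)
    {M : ℝ} (hM0 : 0 ≤ M) (hM : ∀ᵐ x, ‖G x‖ ≤ M)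
    (b : ContDiffBump (0 : EuclideanSpace ℝ (Fin d))) (x y : EuclideanSpace ℝ (Fin d)) :
    ‖(b.normed volume ⋆[lsmul ℝ ℝ, volume] g) x - (b.normed volume ⋆[lsmul ℝ ℝ, volume] g) y‖
      ≤ M * ‖x - y‖ := by
  have hd : Differentiable ℝ (b.normed volume ⋆[lsmul ℝ ℝ, volume] g) :=
    (contDiff_normed_convolution b hg).differentiable (by simp)
  refine convex_univ.norm_image_sub_le_of_norm_fderiv_le (𝕜 := ℝ) (fun z _ => hd z) (fun z _ => ?_)
    (mem_univ y) (mem_univ x)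
  refine ContinuousLinearMap.opNorm_le_bound _ hM0 fun v => ?_
  rw [fderiv_normed_convolution_apply hg hG]
  refine (norm_integral_le_of_norm_le (g := fun t => b.normed volume (z - t) * (M * ‖v‖))
    ((b.integrable_normed.comp_sub_left z).mul_const _) ?_).trans (le_of_eq ?_)
  · filter_upwards [hM] with t ht
    rw [norm_smul, Real.norm_of_nonneg (b.nonneg_normed _)]
    gcongr
    · exact b.nonneg_normed _
    · exact (G t).le_of_opNorm_le ht v
  · rw [integral_mul_const, integral_sub_left_eq_self (b.normed volume) volume z,
      b.integral_normed, one_mul]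

/-- The cruder `d` replaces `√d`, as only some radius depending on `d` is needed. -/
lemma norm_le_of_mem_unitBox {x : EuclideanSpace ℝ (Fin d)} (hx : x ∈ unitBox d) : ‖x‖ ≤ d := by
  rw [EuclideanSpace.norm_eq]
  refine Real.sqrt_le_iff.2 ⟨Nat.cast_nonneg d, ?_⟩
  calc ∑ i, ‖x i‖ ^ 2 ≤ ∑ _i : Fin d, (1 : ℝ) :=
        Finset.sum_le_sum fun i _ => pow_le_one₀ (norm_nonneg _) (hx i)
    _ = d := by simp
    _ ≤ (d : ℝ) ^ 2 := by exact_mod_cast Nat.le_self_pow two_ne_zero d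

lemma isClosed_unitBox : IsClosed (unitBox d) := by
  simp only [unitBox, ofPred_forall]
  exact isClosed_iInter fun i => isClosed_le (by fun_prop) continuous_const

/-- A `W^{1,∞}` function vanishing a.e. outside the unit box has a Lipschitz representative. -/
theorem MemW1Infty.exists_bddLipschitz [FiniteDimensional ℝ F]
    {g : EuclideanSpace ℝ (Fin d) → F} (hg : MemW1Infty g)
    (hg0 : ∀ᵐ x, x ∉ unitBox d → g x = 0) :
    ∃ (u : EuclideanSpace ℝ (Fin d) → F) (K : ℝ), BddLipschitz u K d ∧ g =ᵐ[volume] u := by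
  obtain ⟨hg1, G, hGtop, hG⟩ := hg
  have : CompleteSpace F := FiniteDimensional.complete ℝ F
  have hloc : LocallyIntegrable g := hg1.locallyIntegrable le_top
  set M : ℝ := (eLpNormEssSup G volume).toReal
  have hM : ∀ᵐ x, ‖G x‖ ≤ M := by
    have ht : eLpNormEssSup G volume ≠ ⊤ := by
      have := hGtop.eLpNorm_ne_top
      rwa [eLpNorm_exponent_top] at this
    filter_upwards [enorm_ae_le_eLpNormEssSup G volume] with x hx
    rw [← toReal_enorm]
    exact ENNReal.toReal_mono ht hx
  have hM0 : 0 ≤ M := ENNReal.toReal_nonneg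
  set A : Set (EuclideanSpace ℝ (Fin d)) := {x | Tendsto (fun n =>
    ((shrinkingBump (EuclideanSpace ℝ (Fin d)) n).normed volume ⋆[lsmul ℝ ℝ, volume] g) x)
      atTop (𝓝 (g x))}
  have hA : ∀ᵐ x, x ∈ A := ContDiffBump.ae_convolution_tendsto_right_of_locallyIntegrable
    tendsto_shrinkingBump_rOut (Eventually.of_forall shrinkingBump_rOut_le_mul) hloc
  -- The uniform Lipschitz bound of the mollifications passes to the limit on the full-measure set
  -- `A` of convergence points.
  have hlipA : LipschitzOnWith ⟨M, hM0⟩ g A := by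
    refine LipschitzOnWith.of_dist_le_mul fun x hx y hy => ?_
    rw [dist_eq_norm, dist_eq_norm]
    exact le_of_tendsto (hx.sub hy).norm (Eventually.of_forall fun n =>
      norm_normed_convolution_sub_le hloc hG hM0 hM _ x y)
  obtain ⟨u, hu, hgu⟩ := hlipA.extend_finite_dimension
  have hae : g =ᵐ[volume] u := hA.mono fun x hx => hgu hx
  -- The set outside the closed box where the continuous `u` is nonzero is open and null, hence
  -- empty.
  have hzero : ∀ x, x ∉ unitBox d → u x = 0 := by
    have ho : IsOpen ((unitBox d)ᶜ ∩ {x | u x ≠ 0}) :=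
      isClosed_unitBox.isOpen_compl.inter (isOpen_ne_fun hu.continuous continuous_const)
    have hnull : volume ((unitBox d)ᶜ ∩ {x | u x ≠ 0}) = 0 := by
      rw [← compl_mem_ae_iff]
      filter_upwards [hg0, hae] with x h1 h2 h3
      exact h3.2 (h2 ▸ h1 h3.1)
    intro x hx
    by_contra hne
    have : x ∈ (unitBox d)ᶜ ∩ {x | u x ≠ 0} := ⟨hx, hne⟩
    rw [(ho.measure_eq_zero_iff volume).1 hnull] at this
    exact this
  have hfar : ∀ x : EuclideanSpace ℝ (Fin d), (d : ℝ) < ‖x‖ → u x = 0 := fun x hx =>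
    hzero x fun h => absurd (norm_le_of_mem_unitBox h) (not_le.2 hx)
  have hcs : HasCompactSupport u :=
    HasCompactSupport.intro (isCompact_closedBall 0 d) fun x hx => hfar x (by simpa using hx)
  obtain ⟨S, hS⟩ := hcs.exists_bound_of_continuous hu.continuous
  set L : ℝ≥0 := lipschitzExtensionConstant F * ⟨M, hM0⟩
  have hS0 : 0 ≤ S := (norm_nonneg _).trans (hS 0)
  -- `L` covers points at distance at most 1, and `2 * S` covers the others.
  refine ⟨u, L + 2 * S, ⟨fun x y => ?_, hfar⟩, hae⟩
  have h1 : ‖u x - u y‖ ≤ L * ‖x - y‖ := by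
    simpa only [dist_eq_norm] using hu.dist_le_mul x y
  rcases le_total ‖x - y‖ 1 with h | h
  · rw [min_eq_left h]
    exact h1.trans (by gcongr; linarith)
  · rw [min_eq_right h, mul_one]
    have := norm_sub_le (u x) (u y)
    have := hS x; have := hS y
    have : (0 : ℝ) ≤ L := L.2
    linarith

lemma fracLaplacian_congr_ae {g u : EuclideanSpace ℝ (Fin d) → F} (h : g =ᵐ[volume] u) :
    fracLaplacian γ g =ᵐ[volume] fracLaplacian γ u := by
  filter_upwards [h] with x hx
  simp only [fracLaplacian]
  congr 1
  refine integral_congr_ae ?_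
  filter_upwards [h] with y hy
  rw [hx, hy]

end LipschitzRepresentative

/-! ### The duality estimate: near and far contributions. -/

noncomputable section Pairing

variable {d : ℕ} {F : Type*} [NormedAddCommGroup F] [InnerProductSpace ℝ F]
  [FiniteDimensional ℝ F] {γ : ℝ}

lemma MemBMO.oscillationBound {ψ : EuclideanSpace ℝ (Fin d) → F} {N : ℝ≥0∞} (h : MemBMO ψ)
    (hN : bmoNorm ψ ≤ N) : OscillationBound volume ψ N where
  locallyIntegrable := h.1
  lintegral_le x r hr := by
    have h1 : ⨍⁻ y in ball x r, ‖ψ y - ⨍ z in ball x r, ψ z ∂volume‖ₑ ∂volume ≤ N :=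
      le_trans
        (by exact le_iSup_of_le x (le_iSup_of_le r (le_iSup_of_le hr le_rfl))) hN
    rw [setLAverage_eq] at h1
    exact (ENNReal.div_le_iff (measure_ball_ne_zero' x hr) measure_ball_lt_top.ne).1 h1

/-- The tail estimate treats `ψ - m`, and the constant `m` is harmless because the weight is
integrable. This makes the pairing with a fractional Laplacian absolutely convergent. -/
lemma OscillationBound.integrable_weight (hγ0 : 0 < γ) {ψ : EuclideanSpace ℝ (Fin d) → F}
    {N : ℝ≥0∞} (h : OscillationBound volume ψ N) (hN : N ≠ ⊤) :
    Integrable fun x => (1 + ‖x‖) ^ (-((d : ℝ) + γ)) * ‖ψ x‖ := by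
  set m := ⨍ z in ball (0 : EuclideanSpace ℝ (Fin d)) 1, ψ z
  have hψm := h.locallyIntegrable.aestronglyMeasurable
  have hwm : AEStronglyMeasurable (fun x : EuclideanSpace ℝ (Fin d) =>
      (1 + ‖x‖) ^ (-((d : ℝ) + γ))) := Measurable.aestronglyMeasurable (by fun_prop)
  have hs : (finrank ℝ (EuclideanSpace ℝ (Fin d)) : ℝ) < (d : ℝ) + γ := by simpa using hγ0
  have hw : Integrable fun x : EuclideanSpace ℝ (Fin d) => (1 + ‖x‖) ^ (-((d : ℝ) + γ)) :=
    integrable_one_add_norm hs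
  have h1 : Integrable fun x => (1 + ‖x‖) ^ (-((d : ℝ) + γ)) * ‖ψ x - m‖ := by
    refine ⟨hwm.mul (hψm.sub aestronglyMeasurable_const).norm, ?_⟩
    refine lt_of_le_of_lt (le_trans (le_of_eq ?_)
      (h.lintegral_weight_le (s := (d : ℝ) + γ) (by positivity) le_rfl))
      (ENNReal.mul_lt_top (tailConst_ne_top hs).lt_top hN.lt_top)
    refine lintegral_congr fun x => ?_
    rw [enorm_mul, enorm_norm, mul_comm, Real.enorm_of_nonneg (by positivity)]
  refine (h1.add (hw.mul_const ‖m‖)).mono' (hwm.mul hψm.norm) (Eventually.of_forall fun x => ?_)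
  rw [Real.norm_of_nonneg (by positivity), Pi.add_apply, ← mul_add]
  gcongr
  simpa using norm_add_le (ψ x - m) m

/-- The constant in the duality estimate `enorm_integral_inner_le`. -/
def pairingConst (d : ℕ) (p γ : ℝ) : ℝ≥0∞ :=
  (johnNirenbergConst (EuclideanSpace ℝ (Fin d)) p.conjExponent *
    volume (ball (0 : EuclideanSpace ℝ (Fin d)) (2 * d))) ^ (1 / p.conjExponent) +
  ENNReal.ofReal (|fracConst d γ| * 4 ^ ((d : ℝ) + γ)) *
    tailConst (volume : Measure (EuclideanSpace ℝ (Fin d))) ((d : ℝ) + γ) (2 * d)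

lemma pairingConst_ne_top {p : ℝ} (hp : 1 < p) (hγ0 : 0 < γ) : pairingConst d p γ ≠ ⊤ := by
  have hq := (Real.HolderConjugate.conjExponent hp).symm.pos
  refine ENNReal.add_ne_top.2 ⟨?_, ?_⟩
  · exact ENNReal.rpow_ne_top_of_nonneg (by positivity)
      (ENNReal.mul_ne_top (johnNirenbergConst_ne_top hq.le) measure_ball_lt_top.ne)
  · exact ENNReal.mul_ne_top ENNReal.ofReal_ne_top (tailConst_ne_top (by simpa using hγ0))

/-- The mean of `ψ` may be subtracted, since fractional Laplacians have integral zero. -/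
lemma enorm_integral_inner_le_lintegral (hd : 1 ≤ d) (hγ0 : 0 < γ) (hγ1 : γ < 1)
    {f ψ u : EuclideanSpace ℝ (Fin d) → F} (hf : Continuous f) (h : IsFracLaplacianOf γ f ψ)
    (hψm : AEStronglyMeasurable ψ)
    (hψ : Integrable fun x => (1 + ‖x‖) ^ (-((d : ℝ) + γ)) * ‖ψ x‖)
    {K ρ : ℝ} (hu : BddLipschitz u K ρ) (hρ : 1 ≤ ρ) (m : F) :
    ‖∫ x, ⟪f x, u x⟫‖ₑ ≤ ∫⁻ x, ‖ψ x - m‖ₑ * ‖fracLaplacian γ u x‖ₑ := by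
  have hLm := (hu.stronglyMeasurable_fracLaplacian (γ := γ) hd).aestronglyMeasurable
    (μ := (volume : Measure (EuclideanSpace ℝ (Fin d))))
  have hLi : Integrable (fracLaplacian γ u) := by
    have := hu.memLp_fracLaplacian hd hγ0 hγ1 hρ le_rfl
    rwa [ENNReal.ofReal_one, memLp_one_iff_integrable] at this
  obtain ⟨B, hB⟩ := BddLipschitz.exists_norm_fracLaplacian_le (F := F) hd hγ0 hγ1 K ρ hρ
  have hi : Integrable fun x => ⟪ψ x, fracLaplacian γ u x⟫ := by
    refine (hψ.const_mul B).mono' (hψm.inner hLm) (Eventually.of_forall fun x => ?_)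
    refine (norm_inner_le_norm _ _).trans ?_
    rw [mul_comm, ← mul_assoc]
    gcongr
    exact hB u hu x
  have hm : ∫ x, ⟪m, fracLaplacian γ u x⟫ = 0 := by
    rw [integral_inner hLi, hu.integral_fracLaplacian_eq_zero hd hγ0 hγ1, inner_zero_right]
  rw [h.integral_inner_eq hd hγ0 hγ1 hf hψm hψ hu hρ]
  have heq : ∫ x, ⟪ψ x, fracLaplacian γ u x⟫ = ∫ x, ⟪ψ x - m, fracLaplacian γ u x⟫ := by
    simp only [inner_sub_left]
    rw [integral_sub hi (hLi.const_inner m), hm, sub_zero]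
  rw [heq]
  refine (enorm_integral_le_lintegral_enorm _).trans (lintegral_mono fun x => ?_)
  rw [← enorm_norm (ψ x - m), ← enorm_norm (fracLaplacian γ u x), ← enorm_mul]
  refine enorm_le_iff_norm_le.2 ?_
  rw [norm_mul, norm_norm, norm_norm]
  exact norm_inner_le_norm _ _

/-- The pairing of `(-Δ)^{γ/2} ψ` with a Lipschitz function supported in the ball of radius `d`. -/
theorem enorm_integral_inner_le (hd : 1 ≤ d) {p : ℝ} (hp : 1 < p) (hγ0 : 0 < γ) (hγ1 : γ < 1)
    {f ψ u : EuclideanSpace ℝ (Fin d) → F} (hf : Continuous f) (h : IsFracLaplacianOf γ f ψ)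
    {N : ℝ≥0∞} (hψ : OscillationBound volume ψ N) (hN0 : N ≠ 0) (hN : N ≠ ⊤) {K : ℝ}
    (hu : BddLipschitz u K d) :
    ‖∫ x, ⟪f x, u x⟫‖ₑ ≤ pairingConst d p γ * N *
      (eLpNorm (fracLaplacian γ u) (ENNReal.ofReal p) volume + eLpNorm u 1 volume) := by
  have : Nonempty (Fin d) := ⟨⟨0, hd⟩⟩
  have hd' : (1 : ℝ) ≤ d := by exact_mod_cast hd
  have hR : (1 : ℝ) ≤ 2 * d := by linarith
  set q := p.conjExponent
  have hpq : p.HolderConjugate q := Real.HolderConjugate.conjExponent hp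
  have hq : 0 < q := hpq.symm.pos
  -- Twice the support radius, so that the complement is exactly the range of the far-field decay.
  set b := ball (0 : EuclideanSpace ℝ (Fin d)) (2 * d)
  set m := ⨍ z in b, ψ z
  have hψm := hψ.locallyIntegrable.aestronglyMeasurable
  have hLm := (hu.stronglyMeasurable_fracLaplacian (γ := γ) hd).aestronglyMeasurable
    (μ := (volume : Measure (EuclideanSpace ℝ (Fin d))))
  refine (enorm_integral_inner_le_lintegral hd hγ0 hγ1 hf h hψm (hψ.integrable_weight hγ0 hN)
    hu hd' m).trans ?_
  rw [← lintegral_add_compl _ (measurableSet_ball : MeasurableSet b)]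
  -- Hölder with the conjugate exponent, then John–Nirenberg for `ψ - m`.
  have hnear : ∫⁻ x in b, ‖ψ x - m‖ₑ * ‖fracLaplacian γ u x‖ₑ
      ≤ (johnNirenbergConst (EuclideanSpace ℝ (Fin d)) q * volume b) ^ (1 / q) * N *
        eLpNorm (fracLaplacian γ u) (ENNReal.ofReal p) volume := by
    refine (ENNReal.lintegral_mul_le_Lp_mul_Lq _ hpq.symm
      (hψm.sub aestronglyMeasurable_const).enorm.restrict hLm.enorm.restrict).trans ?_
    gcongr
    · refine (ENNReal.rpow_le_rpow (hψ.lintegral_rpow_le hN0 hN hq 0 (by linarith))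
        (by positivity)).trans (le_of_eq ?_)
      rw [mul_right_comm, ENNReal.mul_rpow_of_nonneg _ _ (by positivity), ← ENNReal.rpow_mul,
        mul_one_div_cancel hq.ne', ENNReal.rpow_one]
    · rw [eLpNorm_eq_lintegral_rpow_enorm_toReal (by simp; linarith) ENNReal.ofReal_ne_top,
        ENNReal.toReal_ofReal (by linarith)]
      gcongr
      exact Measure.restrict_le_self
  -- Far-field decay extracts `‖u‖_{L^1}`, and the weighted tail estimate bounds what remains.
  have hfar : ∫⁻ x in bᶜ, ‖ψ x - m‖ₑ * ‖fracLaplacian γ u x‖ₑ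
      ≤ ENNReal.ofReal (|fracConst d γ| * 4 ^ ((d : ℝ) + γ)) *
        tailConst (volume : Measure (EuclideanSpace ℝ (Fin d))) ((d : ℝ) + γ) (2 * d) * N *
          eLpNorm u 1 volume := by
    set A : ℝ≥0∞ := ENNReal.ofReal (|fracConst d γ| * 4 ^ ((d : ℝ) + γ)) * eLpNorm u 1 volume
    have hu1 : ENNReal.ofReal (∫ y, ‖u y‖) = eLpNorm u 1 volume := by
      rw [ofReal_integral_norm_eq_lintegral_enorm (hu.integrable hd),
        eLpNorm_one_eq_lintegral_enorm]
    have hA : A ≠ ⊤ := ENNReal.mul_ne_top ENNReal.ofReal_ne_top (hu1 ▸ ENNReal.ofReal_ne_top)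
    calc ∫⁻ x in bᶜ, ‖ψ x - m‖ₑ * ‖fracLaplacian γ u x‖ₑ
        ≤ ∫⁻ x in bᶜ, A * (‖ψ x - m‖ₑ * ENNReal.ofReal ((1 + ‖x‖) ^ (-((d : ℝ) + γ)))) := by
          refine setLIntegral_mono' measurableSet_ball.compl fun x hx => ?_
          rw [mul_left_comm]
          gcongr
          have h1 := hu.norm_fracLaplacian_le_of_far hd hγ0 hd' (x := x)
            (not_lt.1 fun h => hx (mem_ball_zero_iff.2 h))
          simp only [A]
          rw [← ofReal_norm, ← hu1, ← ENNReal.ofReal_mul (by positivity),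
            ← ENNReal.ofReal_mul (by positivity)]
          exact ENNReal.ofReal_le_ofReal (by rwa [mul_assoc |fracConst d γ|])
      _ ≤ ∫⁻ x, A * (‖ψ x - m‖ₑ * ENNReal.ofReal ((1 + ‖x‖) ^ (-((d : ℝ) + γ)))) :=
          setLIntegral_le_lintegral _ _
      _ ≤ A * (tailConst (volume : Measure (EuclideanSpace ℝ (Fin d))) ((d : ℝ) + γ) (2 * d) * N) := by
          rw [lintegral_const_mul' _ _ hA]
          gcongr
          exact hψ.lintegral_weight_le (by positivity) hR
      _ = _ := by simp only [A]; ring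
  refine (add_le_add hnear hfar).trans ?_
  rw [pairingConst, mul_add, add_mul _ _ N]
  gcongr
  · exact le_self_add
  · exact le_add_self

end Pairing
end NegBMO

/-! ### The main theorem. -/

theorem mainTheorem9 (d : ℕ) (hd : 1 ≤ d) {F : Type*} [NormedAddCommGroup F]
    [InnerProductSpace ℝ F] [FiniteDimensional ℝ F]
    (p γ : ℝ) (hp : 1 < p) (hγ0 : 0 < γ) (hγ1 : γ < 1) :
    ∃ C : ℝ, 0 < C ∧
      ∀ f g : EuclideanSpace ℝ (Fin d) → F,
        ContDiff ℝ ∞ f → NegBMO.MemNegBMO γ f →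
        NegBMO.MemW1Infty g → (∀ᵐ x, x ∉ NegBMO.unitBox d → g x = 0) →
          Integrable (fun x => ⟪f x, g x⟫) ∧
          MemLp (NegBMO.fracLaplacian γ g) (ENNReal.ofReal p) ∧
          ∫ x, ⟪f x, g x⟫ ≤
            C * (NegBMO.negBMONorm γ f).toReal *
              ((eLpNorm (NegBMO.fracLaplacian γ g) (ENNReal.ofReal p) volume).toReal +
                (eLpNorm g 1 volume).toReal) := by
  have hCt := NegBMO.pairingConst_ne_top (d := d) hp hγ0
  -- The added 1 only secures strict positivity.
  refine ⟨(NegBMO.pairingConst d p γ).toReal + 1, by positivity, ?_⟩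
  intro f g hf hfB hg hg0
  have hd' : (1 : ℝ) ≤ d := by exact_mod_cast hd
  obtain ⟨u, K, hu, hgu⟩ := hg.exists_bddLipschitz hg0
  have hinner : (fun x => ⟪f x, g x⟫) =ᵐ[volume] fun x => ⟪f x, u x⟫ :=
    hgu.mono fun x hx => by simp only [hx]
  have hL := NegBMO.fracLaplacian_congr_ae (γ := γ) hgu
  have hmem := hu.memLp_fracLaplacian hd hγ0 hγ1 hd' hp.le
  have hu1 : MemLp u 1 := memLp_one_iff_integrable.2 (hu.integrable hd)
  refine ⟨?_, hmem.ae_eq hL.symm, ?_⟩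
  · refine Integrable.congr ?_ hinner.symm
    refine (hf.continuous.inner (hu.continuous hd)).integrable_of_hasCompactSupport ?_
    exact hu.hasCompactSupport.mono fun x hx h0 => hx (by simp [h0])
  rw [integral_congr_ae hinner, eLpNorm_congr_ae hL, eLpNorm_congr_ae hgu]
  set X := (eLpNorm (NegBMO.fracLaplacian γ u) (ENNReal.ofReal p) volume).toReal +
    (eLpNorm u 1 volume).toReal
  have hX : 0 ≤ X := by positivity
  set C := (NegBMO.pairingConst d p γ).toReal
  have hC : 0 ≤ C := ENNReal.toReal_nonneg
  have hfin : NegBMO.negBMONorm γ f ≠ ⊤ := by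
    obtain ⟨ψ, hψ, hψf⟩ := hfB
    exact ne_top_of_le_ne_top hψ.2.ne (iInf₂_le ψ ⟨hψ, hψf⟩)
  set a := (NegBMO.negBMONorm γ f).toReal
  have ha : 0 ≤ a := ENNReal.toReal_nonneg
  -- The slack `ε` selects a `ψ` near the infimum and keeps the oscillation bound nonzero, as
  -- John–Nirenberg requires, even when the norm of `f` is zero. It is then sent to zero.
  have key : ∀ ε : ℝ, 0 < ε → ∫ x, ⟪f x, u x⟫ ≤ C * (a + ε) * X := by
    intro ε hε
    have hlt : NegBMO.negBMONorm γ f < ENNReal.ofReal (a + ε) :=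
      (ENNReal.lt_ofReal_iff_toReal_lt hfin).2 (by linarith)
    obtain ⟨ψ, hψ⟩ := iInf_lt_iff.1 hlt
    obtain ⟨⟨hψB, hψf⟩, hψN⟩ := iInf_lt_iff.1 hψ
    have h1 := NegBMO.enorm_integral_inner_le hd hp hγ0 hγ1 hf.continuous hψf
      (hψB.oscillationBound hψN.le) (ENNReal.ofReal_pos.2 (by linarith)).ne' ENNReal.ofReal_ne_top hu
    have h2 := ENNReal.toReal_mono (by
      exact ENNReal.mul_ne_top (ENNReal.mul_ne_top hCt ENNReal.ofReal_ne_top)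
        (ENNReal.add_ne_top.2 ⟨hmem.eLpNorm_ne_top, hu1.eLpNorm_ne_top⟩)) h1
    rw [toReal_enorm, ENNReal.toReal_mul, ENNReal.toReal_mul,
      ENNReal.toReal_ofReal (by positivity),
      ENNReal.toReal_add hmem.eLpNorm_ne_top hu1.eLpNorm_ne_top] at h2
    exact (Real.le_norm_self _).trans h2
  have hlim : Filter.Tendsto (fun ε : ℝ => C * (a + ε) * X) (nhdsWithin 0 (Set.Ioi 0))
      (nhds (C * (a + 0) * X)) := by
    refine Filter.Tendsto.mono_left (Continuous.tendsto ?_ 0) nhdsWithin_le_nhds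
    fun_prop
  have h3 := ge_of_tendsto hlim (eventually_nhdsWithin_of_forall key)
  rw [add_zero] at h3
  refine h3.trans ?_
  gcongr
  linarith
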